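/- Let $k$ be a field and let $H$ be a commutative Hopf algebra over $k$, with comultiplication $\Delta(h)=h_1\otimes h_2$ and antipode $S$. A (left-right) Yetter-Drinfeld module is a left $H$-module $M$ with a right $H$-comodule structure $\rho(m)=m_0\otimes m_1\in M\otimes_k H$ such that $h_1m_0\otimes h_2m_1=(h_2m)_0\otimes(h_2m)_1h_1$ for all $h\in H$, $m\in M$. Together with the $H$-linear $H$-colinear maps, the Yetter-Drinfeld modules form an abelian category ${}_H\mathcal{YD}^H$. For $X$ in ${}_H\mathcal{YD}^H$ let ${}_H\mathrm{pdim}^H(X)$ and ${}_H\mathrm{injdim}^H(X)$ be the projective and the injective dimension of $X$ in this category, that is, the least $n$ such that $\mathrm{Ext}^i(X,-)=0$ (respectively $\mathrm{Ext}^i(-,X)=0$) in ${}_H\mathcal{YD}^H$ for all $i>n$; they are $\infty$ if there is no such $n$, and $-\infty$ if $X=0$. Let $M,N,P\in{}_H\mathcal{YD}^H$, with $N$ finitely generated projective as an $H$-module. Regard $M\otimes_HN$ as a Yetter-Drinfeld module with $h(m\otimes n)=hm\otimes n$ and $\rho(m\otimes n)=m_0\otimes n_0\otimes n_1m_1$,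 and the $k$-module ${}_H\mathrm{Hom}(N,P)$ of $H$-linear maps as a Yetter-Drinfeld module with $(hf)(n)=hf(n)$ and with the coaction $\rho(f)=f_0\otimes f_1$ determined by $f_0(n)\otimes f_1=f(n_0)_0\otimes f(n_0)_1S(n_1)$ for all $n\in N$. Then 1. ${}_H\mathrm{pdim}^H(M\otimes_HN)\le{}_H\mathrm{pdim}^H(M)$; 2. ${}_H\mathrm{injdim}^H({}_H\mathrm{Hom}(N,P))\le{}_H\mathrm{injdim}^H(P)$. -/

import Mathlib

open scoped TensorProduct
open CategoryTheory

universe w u v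

set_option linter.unusedSectionVars false


/-- A (left-right) Yetter-Drinfeld structure over a commutative Hopf algebra `H` on a left
`H`-module `M`: a coassociative and counital right `H`-coaction `ρ(m) = m₀ ⊗ m₁` such that
`h₁ m₀ ⊗ h₂ m₁ = (h₂ m)₀ ⊗ (h₂ m)₁ h₁` for all `h` and `m`.

In `compat`, the left side applies `(a ⊗ b, m ⊗ c) ↦ a m ⊗ b c` to `Δ(h)` and `ρ(m)`, and the
right side is the image of `h₂ ⊗ h₁` under `b ⊗ a ↦ (b m)₀ ⊗ (b m)₁ a`. -/
class YDModule (k : Type u) (H : Type v) (M : Type w) [Field k] [CommRing H] [HopfAlgebra k H]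
    [AddCommGroup M] [Module k M] [Module H M] [IsScalarTower k H M] where
  coact : M →ₗ[k] M ⊗[k] H
  coassoc : ∀ m : M, TensorProduct.assoc k M H H (coact.rTensor H (coact m)) =
    (Coalgebra.comul (R := k) (A := H)).lTensor M (coact m)
  counit : ∀ m : M, TensorProduct.rid k M
    ((Coalgebra.counit (R := k) (A := H)).lTensor M (coact m)) = m
  compat : ∀ (h : H) (m : M),
    TensorProduct.map₂ (Algebra.lsmul k k M).toLinearMap (LinearMap.mul k H)
        (Coalgebra.comul (R := k) h) (coact m) =
      (LinearMap.mul' k H).lTensor M (TensorProduct.assoc k M H H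
        ((coact ∘ₗ (Algebra.lsmul k k M).toLinearMap.flip m).rTensor H
          (TensorProduct.comm k H H (Coalgebra.comul (R := k) h))))

namespace YDModule

section basics
variable {k : Type u} {H : Type v} [Field k] [CommRing H] [HopfAlgebra k H]

variable (k H) in
/-- The action `(a ⊗ b)(m ⊗ c) = a m ⊗ b c` of the algebra `H ⊗ H` on `M ⊗ H`. -/
noncomputable def act (M : Type w) [AddCommGroup M] [Module k M] [Module H M]
    [IsScalarTower k H M] : H ⊗[k] H →ₐ[k] Module.End k (M ⊗[k] H) :=
  (Module.endTensorEndAlgHom (R := k) (S := k) (A := k) (M := M) (N := H)).comp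
    (Algebra.TensorProduct.map (Algebra.lsmul k k M) (Algebra.lmul k H))

variable (k H) in
/-- The algebra map `h ↦ h₂ ⊗ S(h₁) h₃`. -/
noncomputable def ad : H →ₐ[k] H ⊗[k] H :=
  (Algebra.TensorProduct.lift
    ((Algebra.TensorProduct.includeRight : H →ₐ[k] H ⊗[k] H).comp
      (HopfAlgebra.antipodeAlgHom k H))
    (Bialgebra.comulAlgHom k H) (fun _ _ => mul_comm _ _)).comp (Bialgebra.comulAlgHom k H)

variable {M : Type w} [AddCommGroup M] [Module k M] [Module H M] [IsScalarTower k H M]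
variable {N : Type w} [AddCommGroup N] [Module k N] [Module H N] [IsScalarTower k H N]

@[simp] lemma act_tmul (a b : H) (m : M) (c : H) :
    act k H M (a ⊗ₜ b) (m ⊗ₜ c) = (a • m) ⊗ₜ (b * c) := by
  rfl

lemma act_mul_apply (x y : H ⊗[k] H) (t : M ⊗[k] H) :
    act k H M (x * y) t = act k H M x (act k H M y t) := by
  rw [map_mul]; rfl

lemma act_map (f : M →ₗ[H] N) (x : H ⊗[k] H) (t : M ⊗[k] H) :
    (f.restrictScalars k).rTensor H (act k H M x t) =
      act k H N x ((f.restrictScalars k).rTensor H t) := by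
  induction x with
  | zero => simp
  | add x y hx hy => simp [hx, hy]
  | tmul a b =>
    induction t with
    | zero => simp
    | add x y hx hy => simp [hx, hy]
    | tmul m c => simp


/-- `∑ a ⊗ b ↦ (1 ⊗ γ a) • R b` -/
noncomputable def convAct (γ : H →ₗ[k] H) (R : H →ₗ[k] M ⊗[k] H) : H ⊗[k] H →ₗ[k] M ⊗[k] H :=
  TensorProduct.lift (((act k H M).toLinearMap ∘ₗ
    (Algebra.TensorProduct.includeRight : H →ₐ[k] H ⊗[k] H).toLinearMap ∘ₗ γ).compl₂ R)

@[simp] lemma convAct_tmul (γ : H →ₗ[k] H) (R : H →ₗ[k] M ⊗[k] H) (a b : H) :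
    convAct γ R (a ⊗ₜ b) = act k H M (1 ⊗ₜ γ a) (R b) := rfl

lemma convAct_inv (α β : H →ₗ[k] H)
    (hαβ : ∀ h : H, LinearMap.mul' k H (TensorProduct.map α β (Coalgebra.comul (R := k) h)) =
      algebraMap k H (Coalgebra.counit h))
    (R D : H →ₗ[k] M ⊗[k] H)
    (hD : ∀ h : H, D h = convAct β R (Coalgebra.comul (R := k) h)) (h : H) :
    R h = convAct α D (Coalgebra.comul (R := k) h) := by
  have h1 : D = convAct β R ∘ₗ Coalgebra.comul := LinearMap.ext hD
  have h2 : ∀ x : H ⊗[k] H, convAct α D x =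
      TensorProduct.lift (((act k H M).toLinearMap ∘ₗ
        (Algebra.TensorProduct.includeRight : H →ₐ[k] H ⊗[k] H).toLinearMap ∘ₗ α).compl₂
          (convAct β R)) ((Coalgebra.comul (R := k) (A := H)).lTensor H x) := by
    intro x
    induction x with
    | zero => simp
    | add x y hx hy => simp only [map_add, hx, hy]
    | tmul a b => simp [h1]
  have h3 : ∀ x : (H ⊗[k] H) ⊗[k] H,
      TensorProduct.lift (((act k H M).toLinearMap ∘ₗ
        (Algebra.TensorProduct.includeRight : H →ₐ[k] H ⊗[k] H).toLinearMap ∘ₗ α).compl₂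
          (convAct β R)) (TensorProduct.assoc k H H H x) =
      convAct LinearMap.id R ((LinearMap.mul' k H ∘ₗ TensorProduct.map α β).rTensor H x) := by
    intro x
    induction x with
    | zero => simp
    | add x y hx hy => simp only [map_add, hx, hy]
    | tmul a b =>
      induction a with
      | zero => simp
      | add x y hx hy => simp only [map_add, TensorProduct.add_tmul, hx, hy]
      | tmul a c => simp [← act_mul_apply]
  rw [h2, ← Coalgebra.coassoc_apply, h3, ← LinearMap.rTensor_comp_apply]
  have h4 : (LinearMap.mul' k H ∘ₗ TensorProduct.map α β) ∘ₗ Coalgebra.comul =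
      Algebra.linearMap k H ∘ₗ Coalgebra.counit := LinearMap.ext hαβ
  rw [h4, LinearMap.rTensor_comp, LinearMap.comp_apply, Coalgebra.rTensor_counit_comul]
  simp [← Algebra.TensorProduct.one_def]

lemma map₂_eq_act (x : H ⊗[k] H) (t : M ⊗[k] H) :
    TensorProduct.map₂ (Algebra.lsmul k k M).toLinearMap (LinearMap.mul k H) x t =
      act k H M x t := by
  induction x with
  | zero => simp
  | add x y hx hy => simp [hx, hy]
  | tmul a b =>
    induction t with
    | zero => simp
    | add x y hx hy => simp only [map_add, hx, hy]
    | tmul m c => simp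

lemma rhs_eq_conv (R : H →ₗ[k] M ⊗[k] H) (x : H ⊗[k] H) :
    (LinearMap.mul' k H).lTensor M (TensorProduct.assoc k M H H
        (R.rTensor H (TensorProduct.comm k H H x))) = convAct LinearMap.id R x := by
  induction x with
  | zero => simp
  | add x y hx hy => simp only [map_add, hx, hy]
  | tmul a b =>
    simp only [TensorProduct.comm_tmul, LinearMap.rTensor_tmul, convAct_tmul]
    induction R b with
    | zero => simp
    | add x y hx hy => simp only [map_add, TensorProduct.add_tmul, hx, hy]
    | tmul m c => simp [mul_comm]

lemma convAct_antipode (t : M ⊗[k] H) (h : H) :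
    convAct (HopfAlgebra.antipode k) (((act k H M).toLinearMap.flip t) ∘ₗ
      Coalgebra.comul) (Coalgebra.comul (R := k) h) = act k H M (ad k H h) t := by
  simp only [ad, AlgHom.comp_apply, Bialgebra.comulAlgHom_apply]
  induction Coalgebra.comul (R := k) h with
  | zero => simp
  | add x y hx hy => simp only [map_add, hx, hy, LinearMap.add_apply]
  | tmul a b =>
    exact (act_mul_apply (1 ⊗ₜ HopfAlgebra.antipode k a) (Coalgebra.comul b) t).symm

/-- The compatibility condition in the form `ρ(h m) = h₂ m₀ ⊗ h₃ m₁ S(h₁)`. -/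
lemma compat_iff (ρ : M →ₗ[k] M ⊗[k] H) (m : M) :
    (∀ h : H, TensorProduct.map₂ (Algebra.lsmul k k M).toLinearMap (LinearMap.mul k H)
        (Coalgebra.comul (R := k) h) (ρ m) =
      (LinearMap.mul' k H).lTensor M (TensorProduct.assoc k M H H
        ((ρ ∘ₗ (Algebra.lsmul k k M).toLinearMap.flip m).rTensor H
          (TensorProduct.comm k H H (Coalgebra.comul (R := k) h))))) ↔
    ∀ h : H, ρ (h • m) = act k H M (ad k H h) (ρ m) := by
  simp only [map₂_eq_act, rhs_eq_conv, ← convAct_antipode]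
  constructor
  · intro hc h
    exact convAct_inv (HopfAlgebra.antipode k) LinearMap.id
      (fun h => HopfAlgebra.mul_antipode_rTensor_comul_apply h)
      (ρ ∘ₗ (Algebra.lsmul k k M).toLinearMap.flip m)
      (((act k H M).toLinearMap.flip (ρ m)) ∘ₗ Coalgebra.comul) (fun h => hc h) h
  · intro hc h
    exact convAct_inv LinearMap.id (HopfAlgebra.antipode k)
      (fun h => HopfAlgebra.mul_antipode_lTensor_comul_apply h)
      (((act k H M).toLinearMap.flip (ρ m)) ∘ₗ Coalgebra.comul)
      (ρ ∘ₗ (Algebra.lsmul k k M).toLinearMap.flip m) (fun h => hc h) h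


lemma coact_smul [YDModule k H M] (h : H) (m : M) :
    coact (k := k) (H := H) (h • m) = act k H M (ad k H h) (coact m) :=
  (compat_iff (k := k) (H := H) coact m).1 (fun h => compat h m) h

lemma assoc_rTensor_map (f : M →ₗ[k] N) (ρM : M →ₗ[k] M ⊗[k] H) (ρN : N →ₗ[k] N ⊗[k] H)
    (hf : ∀ m, ρN (f m) = f.rTensor H (ρM m)) (t : M ⊗[k] H) :
    TensorProduct.assoc k N H H (ρN.rTensor H (f.rTensor H t)) =
      f.rTensor (H ⊗[k] H) (TensorProduct.assoc k M H H (ρM.rTensor H t)) := by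
  induction t with
  | zero => simp
  | add x y hx hy => simp only [map_add, hx, hy]
  | tmul m a =>
    simp only [LinearMap.rTensor_tmul, hf]
    induction ρM m with
    | zero => simp
    | add x y hx hy => simp only [map_add, TensorProduct.add_tmul, hx, hy]
    | tmul m b => simp

lemma lTensor_map {P Q : Type*} [AddCommGroup P] [Module k P] [AddCommGroup Q] [Module k Q]
    (f : M →ₗ[k] N) (g : P →ₗ[k] Q) (t : M ⊗[k] P) :
    g.lTensor N (f.rTensor P t) = f.rTensor Q (g.lTensor M t) := by
  induction t with
  | zero => simp
  | add x y hx hy => simp only [map_add, hx, hy]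
  | tmul m a => simp

/-- A linear subobject of a Yetter-Drinfeld module. -/
@[reducible] def ofInjective [YDModule k H N] (f : M →ₗ[H] N) (hf : Function.Injective f)
    (ρ : M →ₗ[k] M ⊗[k] H)
    (hρ : ∀ m, coact (f m) = (f.restrictScalars k).rTensor H (ρ m)) : YDModule k H M where
  coact := ρ
  coassoc m := by
    apply Module.Flat.rTensor_preserves_injective_linearMap (M := H ⊗[k] H)
      (f.restrictScalars k) hf
    rw [← assoc_rTensor_map (f.restrictScalars k) ρ coact hρ, ← lTensor_map]
    have := coassoc (k := k) (H := H) (f m)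
    rw [hρ] at this
    exact this
  counit m := by
    apply hf
    have := counit (k := k) (H := H) (f m)
    rw [hρ, lTensor_map] at this
    refine Eq.trans ?_ this
    generalize (Coalgebra.counit (R := k) (A := H)).lTensor M (ρ m) = t
    induction t with
    | zero => simp
    | add x y hx hy => simp only [map_add, hx, hy]
    | tmul m a => exact (f.restrictScalars k).map_smul _ _
  compat h m := by
    revert h
    rw [compat_iff]
    intro h
    apply Module.Flat.rTensor_preserves_injective_linearMap (M := H) (f.restrictScalars k) hf
    rw [act_map, ← hρ, ← hρ, ← coact_smul, map_smul]

section at_image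
variable [YDModule k H M] (f : M →ₗ[H] N) (ρ : N →ₗ[k] N ⊗[k] H)
    (m : M)

lemma coassoc_at (hρ : ∀ m, ρ (f m) = (f.restrictScalars k).rTensor H (coact m)) :
    TensorProduct.assoc k N H H (ρ.rTensor H (ρ (f m))) =
    (Coalgebra.comul (R := k) (A := H)).lTensor N (ρ (f m)) := by
  rw [hρ, assoc_rTensor_map (f.restrictScalars k) coact ρ hρ, lTensor_map, coassoc]

lemma counit_at (hρ : ∀ m, ρ (f m) = (f.restrictScalars k).rTensor H (coact m)) :
    TensorProduct.rid k N
      ((Coalgebra.counit (R := k) (A := H)).lTensor N (ρ (f m))) = f m := by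
  rw [hρ, lTensor_map]
  have := congrArg f (counit (k := k) (H := H) m)
  refine Eq.trans ?_ this
  generalize (Coalgebra.counit (R := k) (A := H)).lTensor M (coact m) = t
  induction t with
  | zero => simp
  | add x y hx hy => simp only [map_add, hx, hy]
  | tmul m a => exact ((f.restrictScalars k).map_smul _ _).symm

lemma coact_smul_at (hρ : ∀ m, ρ (f m) = (f.restrictScalars k).rTensor H (coact m)) (h : H) :
    ρ (h • f m) = act k H N (ad k H h) (ρ (f m)) := by
  rw [hρ, ← act_map, ← coact_smul, ← map_smul, hρ]

end at_image

/-- A linear quotient of a Yetter-Drinfeld module. -/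
@[reducible] def ofSurjective [YDModule k H M] (f : M →ₗ[H] N) (hf : Function.Surjective f)
    (ρ : N →ₗ[k] N ⊗[k] H)
    (hρ : ∀ m, ρ (f m) = (f.restrictScalars k).rTensor H (coact m)) : YDModule k H N where
  coact := ρ
  coassoc n := by
    obtain ⟨m, rfl⟩ := hf n
    exact coassoc_at f ρ m hρ
  counit n := by
    obtain ⟨m, rfl⟩ := hf n
    exact counit_at f ρ m hρ
  compat h n := by
    revert h
    rw [compat_iff]
    intro h
    obtain ⟨m, rfl⟩ := hf n
    exact coact_smul_at f ρ m hρ h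

/-- The direct sum of two Yetter-Drinfeld modules. -/
noncomputable instance prod [YDModule k H M] [YDModule k H N] : YDModule k H (M × N) :=
  let ρ : M × N →ₗ[k] (M × N) ⊗[k] H :=
    (LinearMap.inl k M N).rTensor H ∘ₗ coact ∘ₗ LinearMap.fst k M N +
      (LinearMap.inr k M N).rTensor H ∘ₗ coact ∘ₗ LinearMap.snd k M N
  have h1 : ∀ m, ρ (LinearMap.inl H M N m) =
      ((LinearMap.inl H M N).restrictScalars k).rTensor H (coact m) := fun m => by
    simp [ρ]; rfl
  have h2 : ∀ n, ρ (LinearMap.inr H M N n) =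
      ((LinearMap.inr H M N).restrictScalars k).rTensor H (coact n) := fun n => by
    simp [ρ]; rfl
  have h3 : ∀ x : M × N, x = LinearMap.inl H M N x.1 + LinearMap.inr H M N x.2 := fun x => by
    simp
  { coact := ρ
    coassoc := fun x => by
      rw [h3 x]
      simp only [map_add]
      rw [coassoc_at (LinearMap.inl H M N) ρ x.1 h1, coassoc_at (LinearMap.inr H M N) ρ x.2 h2]
    counit := fun x => by
      rw [h3 x]
      simp only [map_add]
      rw [counit_at (LinearMap.inl H M N) ρ x.1 h1, counit_at (LinearMap.inr H M N) ρ x.2 h2]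
    compat := fun h x => by
      revert h
      rw [compat_iff]
      intro h
      rw [h3 x, smul_add]
      simp only [map_add]
      rw [coact_smul_at (LinearMap.inl H M N) ρ x.1 h1,
        coact_smul_at (LinearMap.inr H M N) ρ x.2 h2] }

lemma coact_prod [YDModule k H M] [YDModule k H N] (x : M × N) :
    coact (k := k) (H := H) x = (LinearMap.inl k M N).rTensor H (coact x.1) +
      (LinearMap.inr k M N).rTensor H (coact x.2) := rfl

lemma inl_colinear [YDModule k H M] [YDModule k H N] (x : M) :
    coact (k := k) (H := H) (LinearMap.inl H M N x) =
      ((LinearMap.inl H M N).restrictScalars k).rTensor H (coact x) := by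
  rw [coact_prod]
  simp
  rfl

lemma inr_colinear [YDModule k H M] [YDModule k H N] (x : N) :
    coact (k := k) (H := H) (LinearMap.inr H M N x) =
      ((LinearMap.inr H M N).restrictScalars k).rTensor H (coact x) := by
  rw [coact_prod]
  simp
  rfl

lemma fst_colinear [YDModule k H M] [YDModule k H N] (x : M × N) :
    coact (k := k) (H := H) (LinearMap.fst H M N x) =
      ((LinearMap.fst H M N).restrictScalars k).rTensor H (coact x) := by
  rw [coact_prod, map_add, ← LinearMap.rTensor_comp_apply, ← LinearMap.rTensor_comp_apply]
  change _ = (LinearMap.fst k M N ∘ₗ LinearMap.inl k M N).rTensor H _ +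
    (LinearMap.fst k M N ∘ₗ LinearMap.inr k M N).rTensor H _
  rw [LinearMap.fst_comp_inl, LinearMap.fst_comp_inr]
  simp

lemma snd_colinear [YDModule k H M] [YDModule k H N] (x : M × N) :
    coact (k := k) (H := H) (LinearMap.snd H M N x) =
      ((LinearMap.snd H M N).restrictScalars k).rTensor H (coact x) := by
  rw [coact_prod, map_add, ← LinearMap.rTensor_comp_apply, ← LinearMap.rTensor_comp_apply]
  change _ = (LinearMap.snd k M N ∘ₗ LinearMap.inl k M N).rTensor H _ +
    (LinearMap.snd k M N ∘ₗ LinearMap.inr k M N).rTensor H _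
  rw [LinearMap.snd_comp_inl, LinearMap.snd_comp_inr]
  simp

instance punit : YDModule k H PUnit.{w + 1} where
  coact := 0
  coassoc _ := by simp
  counit _ := rfl
  compat _ _ := by
    simp only [LinearMap.zero_comp, LinearMap.rTensor_zero, LinearMap.zero_apply, map_zero]

lemma ker_injective (f : M →ₗ[H] N) : Function.Injective
    (((LinearMap.ker f).subtype.restrictScalars k).rTensor H) :=
  Module.Flat.rTensor_preserves_injective_linearMap (M := H)
    ((LinearMap.ker f).subtype.restrictScalars k) (LinearMap.ker f).injective_subtype

lemma coact_mem_range [YDModule k H M] [YDModule k H N] (f : M →ₗ[H] N)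
    (hf : ∀ m, coact (f m) = (f.restrictScalars k).rTensor H (coact m)) (x : LinearMap.ker f) :
    coact (k := k) (H := H) (x : M) ∈
      LinearMap.range (((LinearMap.ker f).subtype.restrictScalars k).rTensor H) := by
  have he : Function.Exact ((LinearMap.ker f).subtype.restrictScalars k)
      (f.restrictScalars k) := fun x => by simp
  refine (Module.Flat.rTensor_exact H he _).1 ?_
  rw [← hf, x.2, map_zero]

/-- The Yetter-Drinfeld structure on the kernel of an `H`-linear `H`-colinear map: the coaction
is the restriction. -/
@[reducible] noncomputable def ker [YDModule k H M] [YDModule k H N] (f : M →ₗ[H] N)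
    (hf : ∀ m, coact (f m) = (f.restrictScalars k).rTensor H (coact m)) :
    YDModule k H (LinearMap.ker f) :=
  ofInjective (LinearMap.ker f).subtype (LinearMap.ker f).injective_subtype
    ((LinearEquiv.ofInjective _ (ker_injective f)).symm.toLinearMap ∘ₗ
      LinearMap.codRestrict _
        (coact ∘ₗ (LinearMap.ker f).subtype.restrictScalars k) (coact_mem_range f hf))
    (fun x => congrArg Subtype.val ((LinearEquiv.ofInjective _ (ker_injective f)).apply_symm_apply
      ⟨coact (x : M), coact_mem_range f hf x⟩).symm)

lemma coact_ker [YDModule k H M] [YDModule k H N] (f : M →ₗ[H] N)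
    (hf : ∀ m, coact (f m) = (f.restrictScalars k).rTensor H (coact m)) (x : LinearMap.ker f) :
    coact (k := k) (H := H) (x : M) =
      ((LinearMap.ker f).subtype.restrictScalars k).rTensor H ((ker f hf).coact x) :=
  congrArg Subtype.val ((LinearEquiv.ofInjective _ (ker_injective f)).apply_symm_apply
    ⟨coact (x : M), coact_mem_range f hf x⟩).symm

/-- The coaction on the cokernel of a colinear map. -/
@[reducible] noncomputable def coker [YDModule k H M] [YDModule k H N] (f : M →ₗ[H] N)
    (hf : ∀ m, coact (f m) = (f.restrictScalars k).rTensor H (coact m)) :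
    YDModule k H (N ⧸ LinearMap.range f) :=
  ofSurjective (LinearMap.range f).mkQ (LinearMap.range f).mkQ_surjective
    (((LinearMap.range f).restrictScalars k).liftQ
      (((LinearMap.range f).mkQ.restrictScalars k).rTensor H ∘ₗ coact) (by
        rintro _ ⟨m, rfl⟩
        rw [LinearMap.mem_ker, LinearMap.comp_apply, hf, ← LinearMap.comp_apply,
          ← LinearMap.rTensor_comp, ← LinearMap.restrictScalars_comp,
          LinearMap.range_mkQ_comp]
        rw [show (0 : M →ₗ[H] N ⧸ LinearMap.range f).restrictScalars k = 0 from rfl]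
        simp))
    (fun _ => rfl)

section tensor

variable (k H M N) in
/-- The map `(m ⊗ a, n ⊗ b) ↦ (m ⊗ n) ⊗ b a`. -/
noncomputable def tensorMul :
    M ⊗[k] H →ₗ[k] N ⊗[k] H →ₗ[k] (M ⊗[H] N) ⊗[k] H :=
  TensorProduct.map₂
    (LinearMap.mk₂ k (fun m n => m ⊗ₜ[H] n) TensorProduct.add_tmul (fun _ _ _ => rfl)
      TensorProduct.tmul_add (fun c m n => by rw [TensorProduct.tmul_smul]))
    (LinearMap.mul k H).flip

@[simp] lemma tensorMul_tmul (m : M) (a : H) (n : N) (b : H) :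
    tensorMul k H M N (m ⊗ₜ a) (n ⊗ₜ b) = (m ⊗ₜ[H] n) ⊗ₜ[k] (b * a) := rfl

lemma tensorMul_act_left (x : H ⊗[k] H) (s : M ⊗[k] H) (t : N ⊗[k] H) :
    tensorMul k H M N (act k H M x s) t =
      act k H (M ⊗[H] N) x (tensorMul k H M N s t) := by
  induction x with
  | zero => simp
  | add x y hx hy => simp only [map_add, LinearMap.add_apply, hx, hy]
  | tmul a b =>
    induction s with
    | zero => simp
    | add x y hx hy => simp only [map_add, LinearMap.add_apply, hx, hy]
    | tmul m c =>
      induction t with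
      | zero => simp
      | add x y hx hy => simp only [map_add, hx, hy]
      | tmul n d =>
        simp only [act_tmul, tensorMul_tmul, TensorProduct.smul_tmul']
        rw [mul_left_comm]

lemma tensorMul_act_right (x : H ⊗[k] H) (s : M ⊗[k] H) (t : N ⊗[k] H) :
    tensorMul k H M N s (act k H N x t) =
      act k H (M ⊗[H] N) x (tensorMul k H M N s t) := by
  induction x with
  | zero => simp
  | add x y hx hy => simp only [map_add, LinearMap.add_apply, hx, hy]
  | tmul a b =>
    induction s with
    | zero => simp
    | add x y hx hy => simp only [map_add, LinearMap.add_apply, hx, hy]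
    | tmul m c =>
      induction t with
      | zero => simp
      | add x y hx hy => simp only [map_add, hx, hy]
      | tmul n d =>
        simp only [act_tmul, tensorMul_tmul, TensorProduct.tmul_smul]
        rw [mul_assoc]

variable [YDModule k H M] [YDModule k H N]

variable (k H M N) in
/-- The coaction `m ⊗ n ↦ (m₀ ⊗ n₀) ⊗ n₁ m₁` on `M ⊗_H N`. -/
noncomputable def tensorCoact : M ⊗[H] N →ₗ[k] (M ⊗[H] N) ⊗[k] H :=
  let B : M →ₗ[k] N →ₗ[k] (M ⊗[H] N) ⊗[k] H :=
    (tensorMul k H M N).compl₁₂ (coact (k := k) (H := H)) (coact (k := k) (H := H))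
  let F : M ⊗[H] N →+ (M ⊗[H] N) ⊗[k] H :=
    TensorProduct.liftAddHom (LinearMap.toAddMonoidHom'.comp B.toAddMonoidHom)
      (fun h m n => by
        change tensorMul k H M N (coact (h • m)) (coact n) =
          tensorMul k H M N (coact m) (coact (h • n))
        rw [coact_smul, coact_smul, tensorMul_act_left, tensorMul_act_right])
  { toFun := F
    map_add' := F.map_add
    map_smul' := fun c x => by
      induction x with
      | zero => simp
      | add x y hx hy => rw [smul_add, map_add, map_add, smul_add, hx, hy]
      | tmul m n =>
        change B (c • m) n = c • B m n
        rw [map_smul]; rfl }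

lemma tensorCoact_tmul (m : M) (n : N) :
    tensorCoact k H M N (m ⊗ₜ n) = tensorMul k H M N (coact m) (coact n) := rfl

lemma tensorCoact_coassoc (m : M) (n : N) :
    TensorProduct.assoc k (M ⊗[H] N) H H ((tensorCoact k H M N).rTensor H
      (tensorCoact k H M N (m ⊗ₜ n))) =
    (Coalgebra.comul (R := k) (A := H)).lTensor (M ⊗[H] N) (tensorCoact k H M N (m ⊗ₜ n)) := by
  let ν : M ⊗[k] (H ⊗[k] H) →ₗ[k] N ⊗[k] (H ⊗[k] H) →ₗ[k] (M ⊗[H] N) ⊗[k] (H ⊗[k] H) :=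
    TensorProduct.map₂
      (LinearMap.mk₂ k (fun m n => m ⊗ₜ[H] n) TensorProduct.add_tmul (fun _ _ _ => rfl)
        TensorProduct.tmul_add (fun c m n => by rw [TensorProduct.tmul_smul]))
      (LinearMap.mul k (H ⊗[k] H)).flip
  have hν : ∀ m x n y, ν (m ⊗ₜ x) (n ⊗ₜ y) = (m ⊗ₜ[H] n) ⊗ₜ[k] (y * x) := fun _ _ _ _ => rfl
  have h1 : ∀ (s : M ⊗[k] H) (t : N ⊗[k] H),
      (Coalgebra.comul (R := k) (A := H)).lTensor (M ⊗[H] N) (tensorMul k H M N s t) =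
        ν ((Coalgebra.comul (R := k) (A := H)).lTensor M s)
          ((Coalgebra.comul (R := k) (A := H)).lTensor N t) := by
    intro s t
    induction s with
    | zero => simp
    | add x y hx hy => simp only [map_add, LinearMap.add_apply, hx, hy]
    | tmul m a =>
      induction t with
      | zero => simp
      | add x y hx hy => simp only [map_add, hx, hy]
      | tmul n b => simp [hν]
  have h2 : ∀ (s : M ⊗[k] H) (t : N ⊗[k] H) (a b : H),
      TensorProduct.assoc k (M ⊗[H] N) H H (tensorMul k H M N s t ⊗ₜ[k] (b * a)) =
        ν (TensorProduct.assoc k M H H (s ⊗ₜ a)) (TensorProduct.assoc k N H H (t ⊗ₜ b)) := by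
    intro s t a b
    induction s with
    | zero => simp
    | add x y hx hy =>
      simp only [map_add, LinearMap.add_apply, TensorProduct.add_tmul, hx, hy]
    | tmul m a =>
      induction t with
      | zero => simp
      | add x y hx hy => simp only [map_add, TensorProduct.add_tmul, hx, hy]
      | tmul n b => simp [hν]
  have h3 : ∀ (s : M ⊗[k] H) (t : N ⊗[k] H),
      TensorProduct.assoc k (M ⊗[H] N) H H ((tensorCoact k H M N).rTensor H
        (tensorMul k H M N s t)) =
        ν (TensorProduct.assoc k M H H (coact.rTensor H s))
          (TensorProduct.assoc k N H H (coact.rTensor H t)) := by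
    intro s t
    induction s with
    | zero => simp
    | add x y hx hy => simp only [map_add, LinearMap.add_apply, hx, hy]
    | tmul m a =>
      induction t with
      | zero => simp
      | add x y hx hy => simp only [map_add, hx, hy]
      | tmul n b =>
        simp only [tensorMul_tmul, LinearMap.rTensor_tmul, tensorCoact_tmul, h2]
  rw [tensorCoact_tmul, h1, h3, coassoc, coassoc]

lemma tensorCoact_counit (m : M) (n : N) :
    TensorProduct.rid k (M ⊗[H] N) ((Coalgebra.counit (R := k) (A := H)).lTensor (M ⊗[H] N)
      (tensorCoact k H M N (m ⊗ₜ n))) = m ⊗ₜ n := by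
  have h1 : ∀ (s : M ⊗[k] H) (t : N ⊗[k] H),
      TensorProduct.rid k (M ⊗[H] N) ((Coalgebra.counit (R := k) (A := H)).lTensor (M ⊗[H] N)
        (tensorMul k H M N s t)) =
      TensorProduct.rid k M ((Coalgebra.counit (R := k) (A := H)).lTensor M s) ⊗ₜ[H]
        TensorProduct.rid k N ((Coalgebra.counit (R := k) (A := H)).lTensor N t) := by
    intro s t
    induction s with
    | zero => simp
    | add x y hx hy =>
      simp only [map_add, LinearMap.add_apply, TensorProduct.add_tmul, hx, hy]
    | tmul m a =>
      induction t with
      | zero => simp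
      | add x y hx hy => simp only [map_add, TensorProduct.tmul_add, hx, hy]
      | tmul n b =>
        simp [TensorProduct.smul_tmul', TensorProduct.tmul_smul, mul_smul]
  rw [tensorCoact_tmul, h1, counit, counit]

/-- `M ⊗_H N` is a Yetter-Drinfeld module. -/
noncomputable instance tensor : YDModule k H (M ⊗[H] N) where
  coact := tensorCoact k H M N
  coassoc x := by
    induction x with
    | zero => simp
    | add x y hx hy => simp only [map_add, hx, hy]
    | tmul m n => exact tensorCoact_coassoc m n
  counit x := by
    induction x with
    | zero => simp
    | add x y hx hy => simp only [map_add, hx, hy]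
    | tmul m n => exact tensorCoact_counit m n
  compat h x := by
    revert h
    rw [compat_iff]
    intro h
    induction x with
    | zero => simp
    | add x y hx hy => rw [smul_add, map_add, map_add, map_add, hx, hy]
    | tmul m n =>
      rw [TensorProduct.smul_tmul', tensorCoact_tmul, tensorCoact_tmul, coact_smul,
        tensorMul_act_left]

end tensor

section hom

section antipode
open WithConv Algebra.TensorProduct

lemma toConv_comul : toConv (Bialgebra.comulAlgHom k H) =
    toConv (includeLeft : H →ₐ[k] H ⊗[k] H) * toConv (includeRight : H →ₐ[k] H ⊗[k] H) := by
  rw [AlgHom.convMul_def]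
  congr 1
  rw [← AlgHom.comp_assoc]
  have : (lmul' k (S := H ⊗[k] H)).comp (Algebra.TensorProduct.map
      (includeLeft : H →ₐ[k] H ⊗[k] H) (includeRight : H →ₐ[k] H ⊗[k] H)) = AlgHom.id k _ := by
    ext <;> simp
  exact (congrArg (fun f => AlgHom.comp f (Bialgebra.comulAlgHom k H)) this).symm

lemma inv_mul_group {G : Type*} [Group G] (x g : G) : (x * g)⁻¹ = g⁻¹ * x⁻¹ :=
  mul_inv_rev x g

lemma comul_antipode (h : H) : Coalgebra.comul (R := k) (HopfAlgebra.antipode k h) =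
    TensorProduct.comm k H H (TensorProduct.map (HopfAlgebra.antipode k) (HopfAlgebra.antipode k)
      (Coalgebra.comul (R := k) h)) := by
  have h1 : (toConv (Bialgebra.comulAlgHom k H))⁻¹ =
      (toConv (includeRight : H →ₐ[k] H ⊗[k] H))⁻¹ *
        (toConv (includeLeft : H →ₐ[k] H ⊗[k] H))⁻¹ := by
    rw [toConv_comul]
    exact inv_mul_group (toConv (includeLeft : H →ₐ[k] H ⊗[k] H))
      (toConv (includeRight : H →ₐ[k] H ⊗[k] H))
  have h2 := DFunLike.congr_fun (congrArg ofConv h1) h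
  refine Eq.trans h2 ?_
  rw [AlgHom.convMul_def]
  change (lmul' k (S := H ⊗[k] H)) (Algebra.TensorProduct.map
    ((includeRight : H →ₐ[k] H ⊗[k] H).comp (HopfAlgebra.antipodeAlgHom k H))
    ((includeLeft : H →ₐ[k] H ⊗[k] H).comp (HopfAlgebra.antipodeAlgHom k H))
    (Coalgebra.comul (R := k) h)) = _
  induction Coalgebra.comul (R := k) h with
  | zero => simp
  | add x y hx hy => simp only [map_add, hx, hy]
  | tmul a b => simp

lemma toConv_ad : toConv (ad k H) = (toConv (includeRight : H →ₐ[k] H ⊗[k] H))⁻¹ *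
    (toConv (includeLeft : H →ₐ[k] H ⊗[k] H) * toConv (includeRight : H →ₐ[k] H ⊗[k] H)) := by
  rw [← toConv_comul, AlgHom.convMul_def, ad, ← AlgHom.comp_assoc]
  refine congrArg (fun f => toConv (AlgHom.comp f (Bialgebra.comulAlgHom k H))) ?_
  refine Algebra.TensorProduct.ext' fun a b => ?_
  rfl

variable (k H) in
/-- The algebra map `b ⊗ a ↦ ad(b) (1 ⊗ S(a))`. -/
noncomputable def adMul : H ⊗[k] H →ₐ[k] H ⊗[k] H :=
  Algebra.TensorProduct.lift (ad k H)
    ((includeRight : H →ₐ[k] H ⊗[k] H).comp (HopfAlgebra.antipodeAlgHom k H))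
    (fun _ _ => mul_comm _ _)

lemma adMul_tmul (b a : H) :
    adMul k H (b ⊗ₜ a) = ad k H b * (1 ⊗ₜ HopfAlgebra.antipode k a) := rfl

lemma conj_conj {G : Type*} [Group G] (x g : G) : g⁻¹⁻¹ * (g⁻¹ * (x * g) * g⁻¹) = x := by
  group

lemma adMul_ad (h : H) : adMul k H (ad k H h) = h ⊗ₜ 1 := by
  set x := toConv (includeLeft : H →ₐ[k] H ⊗[k] H) with hx
  set g := toConv (includeRight : H →ₐ[k] H ⊗[k] H) with hg
  have hgi : toConv ((adMul k H).comp g.ofConv) = g⁻¹ := by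
    apply WithConv.ext
    change (adMul k H).comp includeRight = includeRight.comp (HopfAlgebra.antipodeAlgHom k H)
    ext a; simp [adMul_tmul]
  have hxi : toConv ((adMul k H).comp x.ofConv) = toConv (ad k H) := by
    apply WithConv.ext
    change (adMul k H).comp includeLeft = ad k H
    ext a; simp [adMul_tmul, ← Algebra.TensorProduct.one_def]
  have hgii : toConv ((adMul k H).comp (g⁻¹).ofConv) = (g⁻¹)⁻¹ := by
    apply WithConv.ext
    change ((adMul k H).comp g.ofConv).comp (HopfAlgebra.antipodeAlgHom k H) = _
    have := congrArg ofConv hgi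
    change (adMul k H).comp g.ofConv = _ at this
    rw [this]; rfl
  have key : toConv ((adMul k H).comp (toConv (ad k H)).ofConv) = x := by
    rw [toConv_ad, AlgHom.comp_convMul_distrib]
    change toConv ((adMul k H).comp (g⁻¹).ofConv) * toConv ((adMul k H).comp (x * g).ofConv) = _
    rw [AlgHom.comp_convMul_distrib]
    change _ * (toConv ((adMul k H).comp x.ofConv) * toConv ((adMul k H).comp g.ofConv)) = _
    rw [hgi, hxi, hgii, toConv_ad]
    exact conj_conj x g
  exact DFunLike.congr_fun (congrArg ofConv key) h

end antipode

section homTensor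
variable {V : Type*} [AddCommGroup V] [Module k V]

variable (k) in
/-- Evaluation at `n`. -/
noncomputable def ev (n : M) : (M →ₗ[H] N) →ₗ[k] N :=
  (LinearMap.applyₗ' H n : (M →ₗ[H] N) →ₗ[H] N).restrictScalars k

@[simp] lemma ev_apply (n : M) (f : M →ₗ[H] N) : ev k n f = f n := rfl

lemma coord_rTensor {P Q κ : Type*} [AddCommGroup P] [Module k P] [AddCommGroup Q] [Module k Q]
    [DecidableEq κ] (b : Module.Basis κ k V) (f : P →ₗ[k] Q) (t : P ⊗[k] V) (i : κ) :
    TensorProduct.equivFinsuppOfBasisRight b (f.rTensor V t) i =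
      f (TensorProduct.equivFinsuppOfBasisRight b t i) := by
  induction t with
  | zero => simp
  | add x y hx hy => simp only [map_add, Finsupp.add_apply, hx, hy]
  | tmul p v => simp

lemma homTensor_ext (s t : (M →ₗ[H] N) ⊗[k] V)
    (h : ∀ n, (ev k n).rTensor V s = (ev k n).rTensor V t) : s = t := by
  classical
  let b := Module.Basis.ofVectorSpace k V
  apply (TensorProduct.equivFinsuppOfBasisRight b).injective
  ext i n
  have := congrArg (fun z => TensorProduct.equivFinsuppOfBasisRight b z i) (h n)
  simpa only [coord_rTensor, ev_apply] using this

lemma homTensor_exists [Module.Finite H M] (g : M →ₗ[H] N ⊗[k] V) :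
    ∃ t : (M →ₗ[H] N) ⊗[k] V, ∀ n, (ev k n).rTensor V t = g n := by
  classical
  let b := Module.Basis.ofVectorSpace k V
  let e := TensorProduct.equivFinsuppOfBasisRight (M := N) b
  have he : ∀ (h : H) (t : N ⊗[k] V) i, e (h • t) i = h • e t i := by
    intro h t i
    induction t with
    | zero => simp
    | add x y hx hy => rw [smul_add, map_add, map_add, Finsupp.add_apply, Finsupp.add_apply,
        smul_add, hx, hy]
    | tmul p v =>
      rw [TensorProduct.smul_tmul', TensorProduct.equivFinsuppOfBasisRight_apply_tmul_apply,
        TensorProduct.equivFinsuppOfBasisRight_apply_tmul_apply, smul_comm]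
  let c : _ → (M →ₗ[H] N) := fun i =>
    { toFun := fun n => e (g n) i
      map_add' := fun x y => by simp
      map_smul' := fun h x => by simp [he] }
  obtain ⟨s, hs⟩ := (Module.Finite.fg_top : (⊤ : Submodule H M).FG)
  let S := s.biUnion fun n => (e (g n)).support
  have hS : ∀ i, c i ≠ 0 → i ∈ S := by
    intro i hi
    by_contra hn
    apply hi
    refine LinearMap.ext_on hs fun n hns => ?_
    by_contra h0
    exact hn (Finset.mem_biUnion.2 ⟨n, hns, Finsupp.mem_support_iff.2 h0⟩)
  refine ⟨(TensorProduct.equivFinsuppOfBasisRight b).symm (Finsupp.onFinset S c hS), fun n => ?_⟩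
  apply (TensorProduct.equivFinsuppOfBasisRight b).injective
  ext i
  rw [coord_rTensor, LinearEquiv.apply_symm_apply]
  rfl

end homTensor

/-- `n ⊗ a ↦ f(n)₀ ⊗ f(n)₁ S(a)`. -/
noncomputable def homMul [YDModule k H N] (f : M →ₗ[H] N) : M ⊗[k] H →ₗ[k] N ⊗[k] H :=
  (LinearMap.mul' k H).lTensor N ∘ₗ (TensorProduct.assoc k N H H).toLinearMap ∘ₗ
    TensorProduct.map (coact ∘ₗ f.restrictScalars k) (HopfAlgebra.antipode k)

lemma homMul_tmul [YDModule k H N] (f : M →ₗ[H] N) (n : M) (a : H) :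
    homMul f (n ⊗ₜ a) = act k H N (1 ⊗ₜ HopfAlgebra.antipode k a) (coact (f n)) := by
  simp only [homMul, LinearMap.comp_apply, TensorProduct.map_tmul, LinearMap.restrictScalars_apply,
    LinearEquiv.coe_coe]
  induction coact (k := k) (H := H) (f n) with
  | zero => simp
  | add x y hx hy => simp only [map_add, TensorProduct.add_tmul, hx, hy]
  | tmul m c => simp [mul_comm]

lemma homMul_act [YDModule k H N] (f : M →ₗ[H] N) (x : H ⊗[k] H) (t : M ⊗[k] H) :
    homMul f (act k H M x t) = act k H N (adMul k H x) (homMul f t) := by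
  induction x with
  | zero => simp
  | add x y hx hy => simp only [map_add, LinearMap.add_apply, hx, hy]
  | tmul b a =>
    induction t with
    | zero => simp
    | add x y hx hy => simp only [map_add, hx, hy]
    | tmul n c =>
      rw [act_tmul, homMul_tmul, homMul_tmul, adMul_tmul, map_smul, coact_smul, ← act_mul_apply,
        ← act_mul_apply, HopfAlgebra.antipode_mul_distrib]
      congr 2
      rw [show (1 : H) ⊗ₜ[k] (HopfAlgebra.antipode k a * HopfAlgebra.antipode k c) =
        (1 ⊗ₜ HopfAlgebra.antipode k a) * (1 ⊗ₜ HopfAlgebra.antipode k c) by simp]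
      ring

lemma act_one_right (h : H) (t : M ⊗[k] H) : act k H M (h ⊗ₜ 1) t = h • t := by
  induction t with
  | zero => simp
  | add x y hx hy => rw [map_add, smul_add, hx, hy]
  | tmul m a => simp [TensorProduct.smul_tmul']

variable [YDModule k H M] [YDModule k H N]

variable (k) in
/-- The map `n ↦ f(n₀)₀ ⊗ f(n₀)₁ S(n₁)`, which is `H`-linear. -/
noncomputable def homPi (f : M →ₗ[H] N) : M →ₗ[H] N ⊗[k] H where
  toFun n := homMul f (coact (k := k) (H := H) n)
  map_add' x y := by simp
  map_smul' h n := by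
    rw [coact_smul, homMul_act, adMul_ad, act_one_right]; rfl

variable [Module.Finite H M]

variable (k H M N) in
/-- The coaction on `Hom_H(M, N)`: the unique one with
`f₀(m) ⊗ f₁ = f(m₀)₀ ⊗ f(m₀)₁ S(m₁)` for all `m`, see `homCoact_spec` and `homTensor_ext`. -/
noncomputable def homCoact : (M →ₗ[H] N) →ₗ[k] (M →ₗ[H] N) ⊗[k] H where
  toFun f := (homTensor_exists (k := k) (homPi k f)).choose
  map_add' f g := homTensor_ext _ _ fun n => by
    rw [map_add, (homTensor_exists (k := k) (homPi k (f + g))).choose_spec,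
      (homTensor_exists (k := k) (homPi k f)).choose_spec,
      (homTensor_exists (k := k) (homPi k g)).choose_spec]
    change homMul (f + g) (coact n) = homMul f (coact n) + homMul g (coact n)
    induction coact (k := k) (H := H) n with
    | zero => simp
    | add x y hx hy => rw [map_add, map_add, map_add, hx, hy]; abel
    | tmul m a => simp [homMul_tmul]
  map_smul' c f := homTensor_ext _ _ fun n => by
    rw [map_smul, (homTensor_exists (k := k) (homPi k (c • f))).choose_spec, RingHom.id_apply,
      (homTensor_exists (k := k) (homPi k f)).choose_spec]
    change homMul (c • f) (coact n) = c • homMul f (coact n)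
    induction coact (k := k) (H := H) n with
    | zero => simp
    | add x y hx hy => rw [map_add, map_add, smul_add, hx, hy]
    | tmul m a => simp [homMul_tmul]

lemma homCoact_spec (f : M →ₗ[H] N) (n : M) :
    (ev k n).rTensor H (homCoact k H M N f) =
      (LinearMap.mul' k H).lTensor N (TensorProduct.assoc k N H H
        (TensorProduct.map (coact ∘ₗ f.restrictScalars k) (HopfAlgebra.antipode k)
          (coact n))) :=
  (homTensor_exists (k := k) (homPi k f)).choose_spec n

lemma homCoact_spec' (f : M →ₗ[H] N) (n : M) :
    (ev k n).rTensor H (homCoact k H M N f) = homMul f (coact n) :=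
  homCoact_spec f n

lemma homCoact_coassoc (f : M →ₗ[H] N) :
    TensorProduct.assoc k (M →ₗ[H] N) H H
      ((homCoact k H M N).rTensor H (homCoact k H M N f)) =
    (Coalgebra.comul (R := k) (A := H)).lTensor (M →ₗ[H] N) (homCoact k H M N f) := by
  let S := HopfAlgebra.antipode k (A := H)
  let Δ := Coalgebra.comul (R := k) (A := H)
  -- right multiplication on `N ⊗ (H ⊗ H)`
  let R : H ⊗[k] H →ₗ[k] N ⊗[k] (H ⊗[k] H) →ₗ[k] N ⊗[k] (H ⊗[k] H) :=
    LinearMap.lTensorHom N ∘ₗ LinearMap.mul k (H ⊗[k] H)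
  have hR : ∀ x n y, R x (n ⊗ₜ y) = n ⊗ₜ (x * y) := fun _ _ _ => rfl
  let Ω : M ⊗[k] (H ⊗[k] H) →ₗ[k] N ⊗[k] (H ⊗[k] H) :=
    TensorProduct.lift (R.flip ∘ₗ Δ.lTensor N ∘ₗ coact ∘ₗ f.restrictScalars k)
  have hΩ : ∀ n y, Ω (n ⊗ₜ y) = R y (Δ.lTensor N (coact (f n))) := fun _ _ => rfl
  have hΔ : ∀ (a : H) (t : N ⊗[k] H), Δ.lTensor N (act k H N (1 ⊗ₜ a) t) =
      R (Δ a) (Δ.lTensor N t) := by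
    intro a t
    induction t with
    | zero => simp
    | add x y hx hy => simp only [map_add, hx, hy]
    | tmul n b => simp [hR, Δ]
  have hr : ∀ t : M ⊗[k] H, Δ.lTensor N (homMul f t) =
      Ω (((TensorProduct.comm k H H).toLinearMap ∘ₗ TensorProduct.map S S).lTensor M
        (Δ.lTensor M t)) := by
    intro t
    induction t with
    | zero => simp
    | add x y hx hy => simp only [map_add, hx, hy]
    | tmul n a =>
      rw [homMul_tmul, hΔ, LinearMap.lTensor_tmul, LinearMap.lTensor_tmul, hΩ]
      congr 2
      exact comul_antipode a
  -- `q ⊗ c ↦ (1 ⊗ S(c)) ρ(q)`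
  let Λ : (N ⊗[k] H) ⊗[k] H →ₗ[k] N ⊗[k] (H ⊗[k] H) :=
    TensorProduct.lift (LinearMap.flip
      ((R ∘ₗ (Algebra.TensorProduct.includeLeft : H →ₐ[k] H ⊗[k] H).toLinearMap ∘ₗ S).compl₂
        ((TensorProduct.assoc k N H H).toLinearMap ∘ₗ coact.rTensor H)))
  have hΛ : ∀ q c, Λ (q ⊗ₜ c) =
      R (S c ⊗ₜ 1) (TensorProduct.assoc k N H H (coact.rTensor H q)) := fun _ _ => rfl
  have hRR : ∀ x y z, R x (R y z) = R (x * y) z := by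
    intro x y z
    induction z with
    | zero => simp
    | add u v hu hv => simp only [map_add, hu, hv]
    | tmul n w => simp [hR, mul_assoc]
  have hact : ∀ (a : H) (t : N ⊗[k] H), TensorProduct.assoc k N H H
      (coact.rTensor H (act k H N (1 ⊗ₜ a) t)) =
      R (1 ⊗ₜ a) (TensorProduct.assoc k N H H (coact.rTensor H t)) := by
    intro a t
    induction t with
    | zero => simp
    | add x y hx hy => simp only [map_add, hx, hy]
    | tmul n b =>
      simp only [act_tmul, one_smul, LinearMap.rTensor_tmul]
      induction coact (k := k) (H := H) n with
      | zero => simp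
      | add x y hx hy => simp only [map_add, TensorProduct.add_tmul, hx, hy]
      | tmul m c => simp [hR]
  let evL : M →ₗ[k] (M →ₗ[H] N) →ₗ[k] N :=
    { toFun := fun m => ev k m
      map_add' := fun x y => by ext e; simp
      map_smul' := fun c x => by ext e; simp [LinearMap.map_smul_of_tower] }
  let K : (M →ₗ[H] N) ⊗[k] H → (M ⊗[k] H →ₗ[k] N ⊗[k] (H ⊗[k] H)) := fun t =>
    Λ ∘ₗ ((LinearMap.rTensorHom H ∘ₗ evL).flip t).rTensor H
  have hK : ∀ t m c, K t (m ⊗ₜ c) = Λ ((ev k m).rTensor H t ⊗ₜ c) := fun _ _ _ => rfl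
  have hK0 : K 0 = 0 := by simp [K]
  have hKadd : ∀ s t, K (s + t) = K s + K t := fun s t => by
    simp [K, LinearMap.rTensor_add, LinearMap.comp_add]
  have hK1 : ∀ e a u, K (e ⊗ₜ a) u = TensorProduct.assoc k N H H (homMul e u ⊗ₜ a) := by
    intro e a u
    induction u with
    | zero => simp
    | add x y hx hy => simp only [map_add, TensorProduct.add_tmul, hx, hy]
    | tmul m c =>
      rw [hK, homMul_tmul, LinearMap.rTensor_tmul, ev_apply, hΛ, LinearMap.rTensor_tmul]
      induction coact (k := k) (H := H) (e m) with
      | zero => simp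
      | add x y hx hy => simp only [map_add, TensorProduct.add_tmul, hx, hy]
      | tmul m b => simp [hR, S]
  have hl : ∀ (t : (M →ₗ[H] N) ⊗[k] H) (n : M),
      (ev k n).rTensor (H ⊗[k] H) (TensorProduct.assoc k (M →ₗ[H] N) H H
        ((homCoact k H M N).rTensor H t)) = K t (coact n) := by
    intro t n
    induction t with
    | zero => simp [hK0]
    | add x y hx hy => simp only [map_add, hKadd, LinearMap.add_apply, hx, hy]
    | tmul e a =>
      rw [hK1, ← homCoact_spec', LinearMap.rTensor_tmul]
      induction homCoact k H M N e with
      | zero => simp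
      | add x y hx hy => simp only [map_add, TensorProduct.add_tmul, hx, hy]
      | tmul f b => simp
  have hl2 : ∀ (s : M ⊗[k] H) (c : H), Λ (homMul f s ⊗ₜ c) =
      Ω (((TensorProduct.comm k H H).toLinearMap ∘ₗ TensorProduct.map S S).lTensor M
        (TensorProduct.assoc k M H H (s ⊗ₜ c))) := by
    intro s c
    induction s with
    | zero => simp
    | add x y hx hy => simp only [map_add, TensorProduct.add_tmul, hx, hy]
    | tmul m b =>
      rw [hΛ, homMul_tmul, hact, hRR, coassoc]
      simp [hΩ, S, Δ]
  have hl3 : ∀ u : M ⊗[k] H, K (homCoact k H M N f) u =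
      Ω (((TensorProduct.comm k H H).toLinearMap ∘ₗ TensorProduct.map S S).lTensor M
        (TensorProduct.assoc k M H H (coact.rTensor H u))) := by
    intro u
    induction u with
    | zero => simp
    | add x y hx hy => simp only [map_add, hx, hy]
    | tmul m c => rw [hK, homCoact_spec', hl2, LinearMap.rTensor_tmul]
  refine homTensor_ext _ _ fun n => ?_
  have h5 : (ev k n).rTensor (H ⊗[k] H) (Δ.lTensor (M →ₗ[H] N) (homCoact k H M N f)) =
      Δ.lTensor N ((ev k n).rTensor H (homCoact k H M N f)) := (lTensor_map _ _ _).symm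
  rw [hl, hl3, coassoc, h5, homCoact_spec', hr]

lemma homCoact_counit (f : M →ₗ[H] N) :
    TensorProduct.rid k (M →ₗ[H] N)
      ((Coalgebra.counit (R := k) (A := H)).lTensor (M →ₗ[H] N) (homCoact k H M N f)) = f := by
  have h1 : ∀ (t : (M →ₗ[H] N) ⊗[k] H) (n : M), TensorProduct.rid k (M →ₗ[H] N)
      ((Coalgebra.counit (R := k) (A := H)).lTensor (M →ₗ[H] N) t) n =
      TensorProduct.rid k N
        ((Coalgebra.counit (R := k) (A := H)).lTensor N ((ev k n).rTensor H t)) := by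
    intro t n
    induction t with
    | zero => simp
    | add x y hx hy => simp only [map_add, LinearMap.add_apply, hx, hy]
    | tmul e a => simp
  have h2 : ∀ (a : H) (t : N ⊗[k] H), TensorProduct.rid k N
      ((Coalgebra.counit (R := k) (A := H)).lTensor N (act k H N (1 ⊗ₜ a) t)) =
      Coalgebra.counit (R := k) a • TensorProduct.rid k N
        ((Coalgebra.counit (R := k) (A := H)).lTensor N t) := by
    intro a t
    induction t with
    | zero => simp
    | add x y hx hy => simp only [map_add, smul_add, hx, hy]
    | tmul e b => simp [mul_smul]
  have h3 : ∀ u : M ⊗[k] H, TensorProduct.rid k N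
      ((Coalgebra.counit (R := k) (A := H)).lTensor N (homMul f u)) =
      f (TensorProduct.rid k M ((Coalgebra.counit (R := k) (A := H)).lTensor M u)) := by
    intro u
    induction u with
    | zero => simp
    | add x y hx hy => simp only [map_add, hx, hy]
    | tmul m a =>
      rw [homMul_tmul, h2, counit, HopfAlgebra.counit_antipode]
      exact (LinearMap.map_smul_of_tower f (Coalgebra.counit (R := k) a) m).symm
  refine LinearMap.ext fun n => ?_
  rw [h1, homCoact_spec', h3, counit]

lemma homCoact_smul (h : H) (f : M →ₗ[H] N) :
    homCoact k H M N (h • f) = act k H (M →ₗ[H] N) (ad k H h) (homCoact k H M N f) := by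
  refine homTensor_ext _ _ fun n => ?_
  have h1 : (ev k n).rTensor H (act k H (M →ₗ[H] N) (ad k H h) (homCoact k H M N f)) =
      act k H N (ad k H h) ((ev k n).rTensor H (homCoact k H M N f)) :=
    act_map (LinearMap.applyₗ' H n : (M →ₗ[H] N) →ₗ[H] N) _ _
  rw [h1, homCoact_spec', homCoact_spec']
  induction coact (k := k) (H := H) n with
  | zero => simp
  | add x y hx hy => simp only [map_add, hx, hy]
  | tmul m a =>
    rw [homMul_tmul, homMul_tmul, LinearMap.smul_apply, coact_smul, ← act_mul_apply,
      ← act_mul_apply, mul_comm]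

/-- `Hom_H(M, N)` is a Yetter-Drinfeld module when `M` is finitely generated over `H`. -/
noncomputable instance hom : YDModule k H (M →ₗ[H] N) where
  coact := homCoact k H M N
  coassoc := homCoact_coassoc
  counit := homCoact_counit
  compat h f := by
    revert h
    rw [compat_iff]
    exact fun h => homCoact_smul h f

end hom

end basics
end YDModule

/-- The objects of the category of left-right Yetter-Drinfeld modules over `H`. The `k`-module
and `H`-module structures are compatible (`isScalarTower`). -/
structure YetterDrinfeld (k : Type u) (H : Type v) [Field k] [CommRing H] [HopfAlgebra k H] where
  carrier : Type w
  [addCommGroup : AddCommGroup carrier]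
  [moduleBase : Module k carrier]
  [module : Module H carrier]
  [isScalarTower : IsScalarTower k H carrier]
  [ydModule : YDModule k H carrier]

namespace YetterDrinfeld
open YDModule

attribute [instance] addCommGroup moduleBase module isScalarTower ydModule

variable {k : Type u} {H : Type v} [Field k] [CommRing H] [HopfAlgebra k H]

instance : CoeSort (YetterDrinfeld.{w} k H) (Type w) := ⟨carrier⟩

/-- The morphisms of Yetter-Drinfeld modules: `H`-linear and `H`-colinear maps. -/
@[ext] structure Hom (M N : YetterDrinfeld.{w} k H) where
  toLin : M →ₗ[H] N
  colinear : ∀ m : M, coact (k := k) (H := H) (toLin m) =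
    (toLin.restrictScalars k).rTensor H (coact m)

instance : Category (YetterDrinfeld.{w} k H) where
  Hom M N := Hom M N
  id M := ⟨LinearMap.id, fun m => by
    change _ = (LinearMap.id : M →ₗ[k] M).rTensor H _
    simp⟩
  comp f g := ⟨g.toLin ∘ₗ f.toLin, fun m => by
    change _ = ((g.toLin.restrictScalars k) ∘ₗ (f.toLin.restrictScalars k)).rTensor H _
    simp [g.colinear, f.colinear, LinearMap.rTensor_comp]⟩

/-- The `H`-linear map underlying a morphism. -/
def lin {M N : YetterDrinfeld.{w} k H} (f : M ⟶ N) : M →ₗ[H] N := Hom.toLin f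

lemma lin_colinear {M N : YetterDrinfeld.{w} k H} (f : M ⟶ N) (m : M) :
    coact (k := k) (H := H) (lin f m) = ((lin f).restrictScalars k).rTensor H (coact m) :=
  Hom.colinear f m

lemma lin_injective {M N : YetterDrinfeld.{w} k H} :
    Function.Injective (lin : (M ⟶ N) → (M →ₗ[H] N)) := fun _ _ h => Hom.ext h

/-- The morphism given by an `H`-linear `H`-colinear map. -/
def ofLin {M N : YetterDrinfeld.{w} k H} (f : M →ₗ[H] N)
    (hf : ∀ m : M, coact (k := k) (H := H) (f m) = (f.restrictScalars k).rTensor H (coact m)) :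
    M ⟶ N := Hom.mk f hf

@[simp] lemma lin_ofLin {M N : YetterDrinfeld.{w} k H} (f : M →ₗ[H] N) (hf) :
    lin (ofLin (M := M) (N := N) f hf) = f := rfl

@[simp] lemma lin_id (M : YetterDrinfeld.{w} k H) : lin (𝟙 M) = LinearMap.id := rfl

@[simp] lemma lin_comp {L M N : YetterDrinfeld.{w} k H} (f : L ⟶ M) (g : M ⟶ N) :
    lin (f ≫ g) = lin g ∘ₗ lin f := rfl

section additive
variable {M N : YetterDrinfeld.{w} k H}

instance : Zero (M ⟶ N) := ⟨ofLin 0 fun m => by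
  rw [show (0 : M →ₗ[H] N).restrictScalars k = 0 from rfl]; simp⟩
instance : Add (M ⟶ N) := ⟨fun f g => ofLin (lin f + lin g) fun m => by
  rw [show (lin f + lin g).restrictScalars k =
    (lin f).restrictScalars k + (lin g).restrictScalars k from rfl]
  simp [LinearMap.rTensor_add, lin_colinear]⟩
instance : Neg (M ⟶ N) := ⟨fun f => ofLin (-lin f) fun m => by
  rw [show (-lin f).restrictScalars k = -(lin f).restrictScalars k from rfl]
  simp [LinearMap.rTensor_neg, lin_colinear]⟩
instance : Sub (M ⟶ N) := ⟨fun f g => ofLin (lin f - lin g) fun m => by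
  rw [show (lin f - lin g).restrictScalars k =
    (lin f).restrictScalars k - (lin g).restrictScalars k from rfl]
  simp [LinearMap.rTensor_sub, lin_colinear]⟩
instance : SMul ℕ (M ⟶ N) := ⟨fun n f => ofLin (n • lin f) fun m => by
  rw [show (n • lin f).restrictScalars k = n • (lin f).restrictScalars k from rfl]
  rw [← LinearMap.coe_rTensorHom, map_nsmul]
  simp [lin_colinear]⟩
instance : SMul ℤ (M ⟶ N) := ⟨fun n f => ofLin (n • lin f) fun m => by
  rw [show (n • lin f).restrictScalars k = n • (lin f).restrictScalars k from rfl]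
  rw [← LinearMap.coe_rTensorHom, map_zsmul]
  simp [lin_colinear]⟩

@[simp] lemma lin_zero : lin (0 : M ⟶ N) = 0 := rfl
@[simp] lemma lin_add (f g : M ⟶ N) : lin (f + g) = lin f + lin g := rfl
@[simp] lemma lin_neg (f : M ⟶ N) : lin (-f) = -lin f := rfl
@[simp] lemma lin_sub (f g : M ⟶ N) : lin (f - g) = lin f - lin g := rfl

instance : AddCommGroup (M ⟶ N) :=
  lin_injective.addCommGroup lin rfl (fun _ _ => rfl) (fun _ => rfl) (fun _ _ => rfl)
    (fun _ _ => rfl) (fun _ _ => rfl)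

end additive

instance : Preadditive (YetterDrinfeld.{w} k H) where
  add_comp _ _ _ _ _ _ := lin_injective (by ext; simp)
  comp_add _ _ _ _ _ _ := lin_injective (by ext; simp)


section abelian
open Limits
variable {M N : YetterDrinfeld.{w} k H}

lemma exists_lift (f : M ⟶ N) (hf : Function.Injective (lin f)) {W : YetterDrinfeld.{w} k H}
    (s : W ⟶ N) (hs : ∀ x, lin s x ∈ LinearMap.range (lin f)) : ∃ l : W ⟶ M, l ≫ f = s := by
  let l : W →ₗ[H] M := (LinearEquiv.ofInjective (lin f) hf).symm.toLinearMap ∘ₗ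
    LinearMap.codRestrict _ (lin s) hs
  have hl : lin f ∘ₗ l = lin s := LinearMap.ext fun x =>
    congrArg Subtype.val ((LinearEquiv.ofInjective (lin f) hf).apply_symm_apply ⟨lin s x, hs x⟩)
  refine ⟨ofLin l fun x => ?_, lin_injective hl⟩
  apply Module.Flat.rTensor_preserves_injective_linearMap (M := H) ((lin f).restrictScalars k) hf
  rw [← lin_colinear, ← LinearMap.rTensor_comp_apply, ← LinearMap.restrictScalars_comp, hl,
    ← lin_colinear, ← hl]
  rfl

lemma exists_desc (f : M ⟶ N) (hf : Function.Surjective (lin f)) {W : YetterDrinfeld.{w} k H}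
    (s : M ⟶ W) (hs : LinearMap.ker (lin f) ≤ LinearMap.ker (lin s)) :
    ∃ l : N ⟶ W, f ≫ l = s := by
  let l : N →ₗ[H] W := (LinearMap.ker (lin f)).liftQ (lin s) hs ∘ₗ
    ((lin f).quotKerEquivOfSurjective hf).symm.toLinearMap
  have hl : l ∘ₗ lin f = lin s := LinearMap.ext fun x => by
    have : ((lin f).quotKerEquivOfSurjective hf).symm (lin f x) = Submodule.Quotient.mk x := by
      rw [LinearEquiv.symm_apply_eq]; rfl
    simp only [l, LinearMap.comp_apply, LinearEquiv.coe_coe, this]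
    rfl
  refine ⟨ofLin l fun x => ?_, lin_injective hl⟩
  obtain ⟨y, rfl⟩ := hf x
  rw [lin_colinear, ← LinearMap.rTensor_comp_apply, ← LinearMap.restrictScalars_comp, hl,
    ← lin_colinear, ← hl]
  rfl

/-- The kernel of a morphism. -/
noncomputable def kernelObj (f : M ⟶ N) : YetterDrinfeld.{w} k H :=
  letI := YDModule.ker (lin f) (lin_colinear f)
  ⟨LinearMap.ker (lin f)⟩

/-- The inclusion of the kernel. -/
noncomputable def kernelInc (f : M ⟶ N) : kernelObj f ⟶ M :=
  ofLin (M := kernelObj f) (LinearMap.ker (lin f)).subtype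
    (fun x => coact_ker (lin f) (lin_colinear f) x)

lemma kernelInc_comp (f : M ⟶ N) : kernelInc f ≫ f = 0 :=
  lin_injective (LinearMap.ext fun x => x.2)

lemma kernelInc_injective (f : M ⟶ N) : Function.Injective (lin (kernelInc f)) :=
  (LinearMap.ker (lin f)).injective_subtype

/-- The cokernel of a morphism. -/
noncomputable def cokernelObj (f : M ⟶ N) : YetterDrinfeld.{w} k H :=
  letI := YDModule.coker (lin f) (lin_colinear f)
  ⟨N ⧸ LinearMap.range (lin f)⟩

/-- The projection onto the cokernel. -/
noncomputable def cokernelProj (f : M ⟶ N) : N ⟶ cokernelObj f :=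
  ofLin (N := cokernelObj f) (LinearMap.range (lin f)).mkQ (fun _ => rfl)

lemma comp_cokernelProj (f : M ⟶ N) : f ≫ cokernelProj f = 0 :=
  lin_injective (LinearMap.range_mkQ_comp (lin f))

lemma cokernelProj_surjective (f : M ⟶ N) : Function.Surjective (lin (cokernelProj f)) :=
  (LinearMap.range (lin f)).mkQ_surjective

lemma mono_of_injective (f : M ⟶ N) (hf : Function.Injective (lin f)) : Mono f where
  right_cancellation g h e := lin_injective <| LinearMap.ext fun x => hf <|
    LinearMap.congr_fun (congrArg lin e) x

lemma epi_of_surjective (f : M ⟶ N) (hf : Function.Surjective (lin f)) : Epi f where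
  left_cancellation g h e := lin_injective <| LinearMap.ext fun x => by
    obtain ⟨y, rfl⟩ := hf x
    exact LinearMap.congr_fun (congrArg lin e) y

lemma injective_of_mono (f : M ⟶ N) [Mono f] : Function.Injective (lin f) := by
  have h : kernelInc f = 0 := by
    rw [← cancel_mono f, kernelInc_comp, zero_comp]
  rw [injective_iff_map_eq_zero]
  intro x hx
  exact LinearMap.congr_fun (congrArg lin h) (⟨x, hx⟩ : LinearMap.ker (lin f))

lemma surjective_of_epi (f : M ⟶ N) [Epi f] : Function.Surjective (lin f) := by
  have h : cokernelProj f = 0 := by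
    rw [← cancel_epi f, comp_cokernelProj, comp_zero]
  intro x
  have : (LinearMap.range (lin f)).mkQ x = 0 := LinearMap.congr_fun (congrArg lin h) x
  simpa using this

/-- An injective morphism is the kernel of `g` when its range is the kernel of `g`. -/
lemma nonempty_isLimit {L : YetterDrinfeld.{w} k H} (i : L ⟶ M) (g : M ⟶ N) (w : i ≫ g = 0)
    (hi : Function.Injective (lin i))
    (h : LinearMap.ker (lin g) ≤ LinearMap.range (lin i)) :
    Nonempty (IsLimit (KernelFork.ofι i w)) := by
  have key : ∀ {W : YetterDrinfeld.{w} k H} (s : W ⟶ M), s ≫ g = 0 → ∃ l : W ⟶ L, l ≫ i = s :=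
    fun s hs => exists_lift i hi s fun x => h (LinearMap.congr_fun (congrArg lin hs) x)
  have := mono_of_injective i hi
  exact ⟨KernelFork.IsLimit.ofι i w (fun s hs => (key s hs).choose)
    (fun s hs => (key s hs).choose_spec)
    (fun s hs m hm => by rw [← cancel_mono i, hm, (key s hs).choose_spec])⟩

/-- A surjective morphism is the cokernel of `g` when its kernel is the range of `g`. -/
lemma nonempty_isColimit {L : YetterDrinfeld.{w} k H} (g : M ⟶ N) (p : N ⟶ L) (w : g ≫ p = 0)
    (hp : Function.Surjective (lin p))
    (h : LinearMap.ker (lin p) ≤ LinearMap.range (lin g)) :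
    Nonempty (IsColimit (CokernelCofork.ofπ p w)) := by
  have key : ∀ {W : YetterDrinfeld.{w} k H} (s : N ⟶ W), g ≫ s = 0 → ∃ l : L ⟶ W, p ≫ l = s :=
    fun s hs => exists_desc p hp s fun x hx => by
      obtain ⟨y, rfl⟩ := h hx
      exact LinearMap.congr_fun (congrArg lin hs) y
  have := epi_of_surjective p hp
  exact ⟨CokernelCofork.IsColimit.ofπ p w (fun s hs => (key s hs).choose)
    (fun s hs => (key s hs).choose_spec)
    (fun s hs m hm => by rw [← cancel_epi p, hm, (key s hs).choose_spec])⟩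

instance : HasKernels (YetterDrinfeld.{w} k H) where
  has_limit f := ⟨⟨⟨_, (nonempty_isLimit (kernelInc f) f (kernelInc_comp f)
    (kernelInc_injective f) (Submodule.range_subtype _).ge).some⟩⟩⟩

instance : HasCokernels (YetterDrinfeld.{w} k H) where
  has_colimit f := ⟨⟨⟨_, (nonempty_isColimit f (cokernelProj f) (comp_cokernelProj f)
    (cokernelProj_surjective f) (Submodule.ker_mkQ _).le).some⟩⟩⟩

instance : IsNormalMonoCategory (YetterDrinfeld.{w} k H) where
  normalMonoOfMono f _ := ⟨⟨_, cokernelProj f, comp_cokernelProj f,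
    (nonempty_isLimit f (cokernelProj f) _ (injective_of_mono f) (Submodule.ker_mkQ _).le).some⟩⟩

instance : IsNormalEpiCategory (YetterDrinfeld.{w} k H) where
  normalEpiOfEpi f _ := ⟨⟨_, kernelInc f, kernelInc_comp f,
    (nonempty_isColimit (kernelInc f) f _ (surjective_of_epi f)
      (Submodule.range_subtype _).ge).some⟩⟩

instance : HasZeroObject (YetterDrinfeld.{w} k H) where
  zero := ⟨⟨PUnit⟩,
    { unique_to := fun X => ⟨⟨⟨0⟩, fun f => lin_injective (LinearMap.ext fun x => by
        rw [show x = 0 from rfl, map_zero, map_zero])⟩⟩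
      unique_from := fun X => ⟨⟨⟨0⟩, fun f => lin_injective (LinearMap.ext fun x => rfl)⟩⟩ }⟩

/-- The direct sum of two Yetter-Drinfeld modules. -/
noncomputable def prodObj (M N : YetterDrinfeld.{w} k H) : YetterDrinfeld.{w} k H := ⟨M × N⟩

/-- The direct sum with its projections and inclusions. -/
noncomputable def prodBicone (M N : YetterDrinfeld.{w} k H) : BinaryBicone M N where
  pt := prodObj M N
  fst := ofLin (M := prodObj M N) (LinearMap.fst H M N) fst_colinear
  snd := ofLin (M := prodObj M N) (LinearMap.snd H M N) snd_colinear
  inl := ofLin (N := prodObj M N) (LinearMap.inl H M N) inl_colinear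
  inr := ofLin (N := prodObj M N) (LinearMap.inr H M N) inr_colinear
  inl_fst := lin_injective (LinearMap.fst_comp_inl H M N)
  inl_snd := lin_injective (LinearMap.snd_comp_inl H M N)
  inr_fst := lin_injective (LinearMap.fst_comp_inr H M N)
  inr_snd := lin_injective (LinearMap.snd_comp_inr H M N)

instance : HasBinaryBiproducts (YetterDrinfeld.{w} k H) where
  has_binary_biproduct M N := by
    refine hasBinaryBiproduct_of_total (prodBicone M N) (lin_injective ?_)
    refine LinearMap.ext fun (x : M × N) => ?_
    change ((x.1, 0) : M × N) + (0, x.2) = x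
    simp

instance : HasFiniteProducts (YetterDrinfeld.{w} k H) :=
  hasFiniteProducts_of_has_binary_and_terminal

/-- Yetter-Drinfeld modules form an abelian category. -/
noncomputable instance : Abelian (YetterDrinfeld.{w} k H) where

end abelian

/-- The Yetter-Drinfeld module `M ⊗_H N`, with `h (m ⊗ n) = h m ⊗ n = m ⊗ h n` and coaction
`m ⊗ n ↦ (m₀ ⊗ n₀) ⊗ n₁ m₁`. -/
noncomputable def tensorObj (M N : YetterDrinfeld.{w} k H) : YetterDrinfeld.{w} k H :=
  ⟨M ⊗[H] N⟩

/-- The Yetter-Drinfeld module `Hom_H(M, N)` for `M` finitely generated over `H`, with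
`(h f)(m) = h f(m)` and coaction determined by
`f₀(m) ⊗ f₁ = f(m₀)₀ ⊗ f(m₀)₁ S(m₁)` for all `m`. -/
noncomputable def homObj (M N : YetterDrinfeld.{w} k H) [Module.Finite H M] :
    YetterDrinfeld.{w} k H :=
  ⟨M →ₗ[H] N⟩

end YetterDrinfeld

/-! Both inequalities are formal consequences of one adjunction. On Yetter-Drinfeld modules, `- ⊗_H
N` is left adjoint to `Hom_H(N, -)`: the unit `m ↦ (n ↦ m ⊗ n)` and the evaluation `f ⊗ n ↦ f n` of
the usual tensor-hom adjunction over `H` are colinear. After the formulas for the coactions are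
inserted, this comes down to `n₀ ⊗ n₁ S(n₂) = n ⊗ 1` for the unit (`homCoact_mk`) and `n₀ ⊗ S(n₁) n₂
= n ⊗ 1` for the evaluation (`coact_lift_id`). Finite generation of `N` puts the coaction on
`Hom_H(N, -)`; projectivity of `N` makes both functors exact.

Now let `F ⊣ G` be any adjunction of exact functors between abelian categories, with unit `η` and
counit `ε`. Exact functors act on `Ext`. A class `e` in `Ext^i(F X, Y)` can be recovered from its
adjunct `η_X · G(e)` in `Ext^i(X, G Y)`: apply `F`, compose with `ε_Y`, and use a triangle identity.
So `Ext^i(X, -) = 0` forces `Ext^i(F X, -) = 0`, and the dual argument treats injective dimension.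
No projective or injective resolutions are needed.

The recovery uses that `η` and `ε` are natural with respect to `Ext` classes of every degree, not
only morphisms (`comp_mk₀_unit`, `comp_mk₀_counit`). The proof is by induction on the degree: a
class of degree `n + 1` is the class of a short exact sequence times a class of degree `n`
(`exists_extClass_comp`), and for short exact sequences the claim is naturality of the extension
class. This factorization exists because each class of positive degree is killed by some
epimorphism, which is read off from a roof in the derived category. -/

section exactAdjunction

open Limits Abelian

variable {C : Type*} [Category C] [Abelian C] {D : Type*} [Category D] [Abelian D]

/-! ### Complexes mapping to an object placed in a single degree -/

namespace CochainComplex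

open HomologicalComplex

/-- A quasi-isomorphism in degree `i` from a complex concentrated in degrees `≤ i` to a complex
concentrated in degree `i` is an epimorphism in degree `i`. -/
lemma epi_f_of_quasiIsoAt_single {P : C} {K : CochainComplex C ℤ} {i : ℤ}
    (π : K ⟶ (HomologicalComplex.single C (ComplexShape.up ℤ) i).obj P) [K.IsStrictlyLE i]
    [QuasiIsoAt π i] : Epi (π.f i) := by
  -- `K` vanishes in degree `i + 1`, so all of `K.X i` consists of cycles. Hence `π.f i` is, up to
  -- isomorphisms, the projection from cycles to homology followed by the isomorphism that `π`
  -- induces on homology.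
  let e := K.iCyclesIso i (i + 1) (by simp)
    ((K.isZero_of_isStrictlyLE i (i + 1) (by simp)).eq_of_tgt _ _)
  let α := e.inv ≫ K.homologyπ i ≫ homologyMap π i ≫ (singleObjHomologySelfIso _ _ _).hom
  have : π.f i = α ≫ (singleObjXSelf (ComplexShape.up ℤ) i P).inv := by
    rw [← cancel_epi e.hom]
    dsimp [α, e]
    rw [Category.assoc, Category.assoc, Category.assoc, Iso.hom_inv_id_assoc,
      homologyπ_naturality_assoc, homologyπ_singleObjHomologySelfIso_hom_assoc,
      ← singleObjCyclesSelfIso_inv_iCycles, Iso.hom_inv_id_assoc, cyclesMap_i,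
      iCyclesIso_hom]
  rw [this]
  infer_instance

/-- A composite of morphisms of complexes from and to complexes concentrated in degree `i` comes
from a morphism of the objects in degree `i`. -/
lemma mkHomFromSingle_comp {A P : C} {K : CochainComplex C ℤ} {i : ℤ} (φ : A ⟶ K.X i)
    (hφ : ∀ k, (ComplexShape.up ℤ).Rel i k → φ ≫ K.d i k = 0)
    (π : K ⟶ (HomologicalComplex.single C (ComplexShape.up ℤ) i).obj P) :
    mkHomFromSingle φ hφ ≫ π = (HomologicalComplex.single C (ComplexShape.up ℤ) i).map
      (φ ≫ π.f i ≫ (singleObjXSelf (ComplexShape.up ℤ) i P).hom) := by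
  apply from_single_hom_ext
  simp [single_map_f_self]

end CochainComplex

/-! ### Effaceability in the derived category -/

namespace DerivedCategory

/-- Write `φ` as a roof `π⁻¹ g` through a complex `K` that stops in degree `i`. The degree `i` part
of `π` is an epimorphism `K.X i ⟶ P`, and it factors as a map of complexes through the inclusion of
the top term of `K`. Composing with it cancels `π⁻¹` and leaves the restriction of `g` to that top
term, which is zero because `L` has nothing in degree `i`. -/
lemma exists_epi_comp_eq_zero [HasDerivedCategory C] {P : C} {L : CochainComplex C ℤ} {i : ℤ}
    (φ : Q.obj ((CochainComplex.singleFunctor C i).obj P) ⟶ Q.obj L)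
    (n : ℤ) (hn : n < i) [L.IsStrictlyLE n] :
    ∃ (P' : C) (p : P' ⟶ P) (_ : Epi p),
      Q.map ((CochainComplex.singleFunctor C i).map p) ≫ φ = 0 := by
  obtain ⟨K, _, π, h, g, rfl⟩ := right_fac_of_isStrictlyLE φ i
  have hqi := (isIso_Q_map_iff_quasiIso C π).1 h
  let π' : K ⟶ (HomologicalComplex.single C (ComplexShape.up ℤ) i).obj P := π
  have hπ' : QuasiIsoAt π' i := hqi.quasiIsoAt i
  have hπ := CochainComplex.epi_f_of_quasiIsoAt_single π'
  have hd : ∀ k, (ComplexShape.up ℤ).Rel i k → 𝟙 (K.X i) ≫ K.d i k = 0 := by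
    rintro _ rfl
    apply (K.isZero_of_isStrictlyLE i (i + 1) (by simp)).eq_of_tgt
  -- The inclusion of the top term is a chain map because the differential leaving degree `i` is
  -- zero.
  let j : (CochainComplex.singleFunctor C i).obj (K.X i) ⟶ K :=
    HomologicalComplex.mkHomFromSingle (𝟙 _) hd
  have hj : j ≫ g = 0 := by
    apply HomologicalComplex.from_single_hom_ext
    apply (L.isZero_of_isStrictlyLE n i hn).eq_of_tgt
  -- The redundant `𝟙 _` gives the epimorphism the exact shape produced by `mkHomFromSingle_comp`.
  refine ⟨K.X i, 𝟙 _ ≫ π'.f i ≫ (HomologicalComplex.singleObjXSelf (ComplexShape.up ℤ) i P).hom,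
    inferInstance, ?_⟩
  have hjp : (CochainComplex.singleFunctor C i).map _ = j ≫ π :=
    (CochainComplex.mkHomFromSingle_comp (𝟙 _) hd π').symm
  rw [hjp, Q.map_comp, Category.assoc, IsIso.hom_inv_id_assoc, ← Q.map_comp, hj, Q.map_zero]

end DerivedCategory

namespace CategoryTheory

/-! ### Effaceability of Ext and naturality with respect to Ext classes -/

namespace Abelian.Ext

open _root_.DerivedCategory in
/-- Extension groups of positive degree are effaceable: each class is killed by an epimorphism. -/
lemma exists_epi_comp_eq_zero [HasExt.{w} C] {X Y : C} {n : ℕ} (e : Ext X Y (n + 1)) :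
    ∃ (X' : C) (p : X' ⟶ X) (_ : Epi p), (mk₀ p).comp e (zero_add _) = 0 := by
  let := HasDerivedCategory.standard C
  -- A class of degree `n + 1` is a morphism from `X` in degree `0` to the shift of `Y` by `n + 1`.
  -- The shift isomorphism replaces that target by `Y` in degree `-(n + 1)`. Positivity of the
  -- degree enters here: it makes `-(n + 1) < 0`.
  obtain ⟨X', p, hp, h⟩ := DerivedCategory.exists_epi_comp_eq_zero
    (L := (CochainComplex.singleFunctor C (-(n + 1))).obj Y) (i := 0) (P := X)
    (e.hom ≫ ((singleFunctors C).shiftIso (n + 1) (-(n + 1)) 0 (by lia)).hom.app _)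
    (-(n + 1)) (by lia)
  refine ⟨X', p, hp, ?_⟩
  apply homEquiv.injective
  simp only [← cancel_mono (((singleFunctors C).shiftIso (n + 1) (-(n + 1)) 0
    (by lia)).hom.app _), zero_hom, Limits.zero_comp]
  refine Eq.trans ?_ h
  have hc : ((mk₀ p).comp e (zero_add _)).hom = (singleFunctor C 0).map p ≫ e.hom := by
    rw [comp_hom, mk₀_hom, ShiftedHom.mk₀_comp]
  exact (congrArg (fun x => x ≫ ((singleFunctors C).shiftIso (n + 1) (-(n + 1)) 0
    (by lia)).hom.app Y) hc).trans (Category.assoc _ _ _)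

/-- A class of positive degree is the Yoneda product of the class of a short exact sequence
with a class of smaller degree. -/
lemma exists_extClass_comp [HasExt.{w} C] {X Y : C} {n : ℕ} (e : Ext X Y (n + 1)) :
    ∃ (X₁ X₂ : C) (i : X₁ ⟶ X₂) (p : X₂ ⟶ X) (h : i ≫ p = 0)
      (hS : (ShortComplex.mk i p h).ShortExact) (e' : Ext X₁ Y n),
      e = hS.extClass.comp e' (add_comm 1 n) := by
  obtain ⟨X', p, hp, h⟩ := exists_epi_comp_eq_zero e
  have hS : (ShortComplex.mk _ _ (kernel.condition p)).ShortExact :=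
    { exact := ShortComplex.exact_kernel p }
  -- In the long exact sequence of `0 → ker p → X' → X → 0`, a class that dies in `Ext^(n+1)(X', Y)`
  -- comes from `Ext^n(ker p, Y)` by the connecting map, which is multiplication by the extension
  -- class.
  obtain ⟨e', he'⟩ := Ext.contravariant_sequence_exact₃ hS _ e h (add_comm 1 n)
  exact ⟨_, _, _, _, _, hS, e', he'.symm⟩

variable (F : C ⥤ D) [F.Additive] [PreservesFiniteLimits F] [PreservesFiniteColimits F]
  (G : D ⥤ C) [G.Additive] [PreservesFiniteLimits G] [PreservesFiniteColimits G]

/-- Naturality of a transformation `𝟭 C ⟶ F ⋙ G` with respect to extension classes. -/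
lemma comp_mk₀_unit [HasExt.{w} C] [HasExt.{v} D] (η : ∀ X : C, X ⟶ G.obj (F.obj X))
    (hη : ∀ {X Y : C} (f : X ⟶ Y), f ≫ η Y = η X ≫ G.map (F.map f)) {X Y : C} {n : ℕ}
    (e : Ext X Y n) :
    e.comp (mk₀ (η Y)) (add_zero n) =
      (mk₀ (η X)).comp ((e.mapExactFunctor F).mapExactFunctor G) (zero_add n) := by
  induction n generalizing X with
  | zero =>
    obtain ⟨f, rfl⟩ := (mk₀_bijective X Y).2 e
    rw [mapExactFunctor_mk₀, mapExactFunctor_mk₀, mk₀_comp_mk₀, mk₀_comp_mk₀, hη]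
  | succ n ih =>
    obtain ⟨X₁, X₂, i, p, h, hS, e', rfl⟩ := exists_extClass_comp e
    -- The components of `η` form a morphism from the short exact sequence to its image under `F ⋙
    -- G`, so naturality of the extension class gives the degree `1` case.
    have key : hS.extClass.comp (mk₀ (η X₁)) (add_zero 1) =
        (mk₀ (η X)).comp ((hS.extClass.mapExactFunctor F).mapExactFunctor G) (zero_add 1) := by
      refine (ShortComplex.ShortExact.extClass_naturality hS
        ((hS.map_of_exact F).map_of_exact G)
        { τ₁ := η _, τ₂ := η _, τ₃ := η _
          comm₁₂ := (hη _).symm, comm₂₃ := (hη _).symm }).trans ?_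
      exact congrArg (fun x => (mk₀ (η X)).comp x (zero_add 1))
        ((mapExactFunctor_extClass G (hS.map_of_exact F)).symm.trans
          (congrArg (mapExactFunctor G) (mapExactFunctor_extClass F hS).symm))
    -- From here only `key` matters about the extension class `x`: `x · e' · η_Y = x · η_(X₁) ·
    -- GF(e') = η_X · GF(x) · GF(e')`, by the induction hypothesis and then `key`.
    generalize hS.extClass = x at key
    dsimp only at x e' key ⊢
    rw [mapExactFunctor_comp, mapExactFunctor_comp, comp_assoc_of_third_deg_zero, ih,
      ← comp_assoc_of_second_deg_zero, key, comp_assoc _ _ _ (zero_add 1) (add_comm 1 n) (by lia)]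

/-- Naturality of a transformation `G ⋙ F ⟶ 𝟭 D` with respect to extension classes. -/
lemma comp_mk₀_counit [HasExt.{w} C] [HasExt.{v} D] (ε : ∀ X : D, F.obj (G.obj X) ⟶ X)
    (hε : ∀ {X Y : D} (f : X ⟶ Y), F.map (G.map f) ≫ ε Y = ε X ≫ f) {X Y : D} {n : ℕ}
    (e : Ext X Y n) :
    ((e.mapExactFunctor G).mapExactFunctor F).comp (mk₀ (ε Y)) (add_zero n) =
      (mk₀ (ε X)).comp e (zero_add n) := by
  induction n generalizing X with
  | zero =>
    obtain ⟨f, rfl⟩ := (mk₀_bijective X Y).2 e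
    rw [mapExactFunctor_mk₀, mapExactFunctor_mk₀, mk₀_comp_mk₀, mk₀_comp_mk₀, hε]
  | succ n ih =>
    obtain ⟨X₁, X₂, i, p, h, hS, e', rfl⟩ := exists_extClass_comp e
    -- Here the components of `ε` map the image of the short exact sequence under `G ⋙ F` back to
    -- the sequence itself.
    have key : ((hS.extClass.mapExactFunctor G).mapExactFunctor F).comp (mk₀ (ε X₁))
        (add_zero 1) = (mk₀ (ε X)).comp hS.extClass (zero_add 1) := by
      refine Eq.trans ?_ (ShortComplex.ShortExact.extClass_naturality
        ((hS.map_of_exact G).map_of_exact F) hS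
        { τ₁ := ε _, τ₂ := ε _, τ₃ := ε _
          comm₁₂ := (hε _).symm, comm₂₃ := (hε _).symm })
      exact congrArg (fun x => Ext.comp x (mk₀ (ε X₁)) (add_zero 1))
        ((congrArg (mapExactFunctor F) (mapExactFunctor_extClass G hS)).trans
          (mapExactFunctor_extClass F (hS.map_of_exact G)))
    generalize hS.extClass = x at key
    dsimp only at x e' key ⊢
    rw [mapExactFunctor_comp, mapExactFunctor_comp, comp_assoc_of_third_deg_zero, ih,
      ← comp_assoc_of_second_deg_zero, key, comp_assoc _ _ _ (zero_add 1) (add_comm 1 n) (by lia)]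

end Abelian.Ext

/-! ### Homological dimensions along an adjunction of exact functors -/

variable {F : C ⥤ D} [F.Additive] [PreservesFiniteLimits F] [PreservesFiniteColimits F]
  {G : D ⥤ C} [G.Additive] [PreservesFiniteLimits G] [PreservesFiniteColimits G]

-- The adjunct of a class determines it: `F(η_X) · FG(e) · ε_Y = F(η_X) · ε_(F X) · e = e`, by
-- naturality of `ε` on `Ext` and the left triangle identity. The adjunct `η_X · G(e)` lies in
-- `Ext^i(X, G Y)`, which is zero for `i ≥ n`.
open Abelian.Ext in
lemma Adjunction.hasProjectiveDimensionLT_obj (adj : F ⊣ G) (X : C) (n : ℕ)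
    [HasProjectiveDimensionLT X n] : HasProjectiveDimensionLT (F.obj X) n := by
  let := HasExt.standard C
  let := HasExt.standard D
  refine HasProjectiveDimensionLT.mk fun i hi Y e => ?_
  let η (X : C) : X ⟶ G.obj (F.obj X) := adj.unit.app X
  let ε (X : D) : F.obj (G.obj X) ⟶ X := adj.counit.app X
  have h0 : (mk₀ (η X)).comp (e.mapExactFunctor G) (zero_add i) = 0 :=
    Ext.eq_zero_of_hasProjectiveDimensionLT _ n hi
  have h1 := congrArg (fun x => (x.mapExactFunctor F).comp (mk₀ (ε Y)) (add_zero i)) h0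
  rwa [mapExactFunctor_comp, mapExactFunctor_mk₀, mapExactFunctor_zero, Ext.zero_comp,
    comp_assoc_of_third_deg_zero, comp_mk₀_counit F G ε (fun f => adj.counit.naturality f),
    ← comp_assoc_of_second_deg_zero, mk₀_comp_mk₀,
    show F.map (η X) ≫ ε (F.obj X) = 𝟙 _ from adj.left_triangle_components X,
    mk₀_id_comp] at h1

-- Dually, for `e` in `Ext^i(X, G Y)` the class `F(e) · ε_Y` lies in `Ext^i(F X, Y) = 0`, and `η_X ·
-- GF(e) · G(ε_Y) = e · η_(G Y) · G(ε_Y) = e` by naturality of `η` on `Ext` and the right triangle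
-- identity.
open Abelian.Ext in
lemma Adjunction.hasInjectiveDimensionLT_obj (adj : F ⊣ G) (Y : D) (n : ℕ)
    [HasInjectiveDimensionLT Y n] : HasInjectiveDimensionLT (G.obj Y) n := by
  let := HasExt.standard C
  let := HasExt.standard D
  refine HasInjectiveDimensionLT.mk fun i hi X e => ?_
  let η (X : C) : X ⟶ G.obj (F.obj X) := adj.unit.app X
  let ε (X : D) : F.obj (G.obj X) ⟶ X := adj.counit.app X
  have h0 : (e.mapExactFunctor F).comp (mk₀ (ε Y)) (add_zero i) = 0 :=
    Ext.eq_zero_of_hasInjectiveDimensionLT _ n hi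
  have h1 := congrArg (fun x => (mk₀ (η X)).comp (x.mapExactFunctor G) (zero_add i)) h0
  rwa [mapExactFunctor_comp, mapExactFunctor_mk₀, mapExactFunctor_zero, Ext.comp_zero,
    ← comp_assoc_of_third_deg_zero, ← comp_mk₀_unit F G η (fun f => adj.unit.naturality f),
    comp_assoc_of_third_deg_zero, mk₀_comp_mk₀,
    show η (G.obj Y) ≫ G.map (ε Y) = 𝟙 _ from adj.right_triangle_components Y,
    comp_mk₀_id] at h1

/-- The left adjoint in an adjunction of exact functors does not raise projective dimensions. -/
lemma Adjunction.projectiveDimension_obj_le (adj : F ⊣ G) (X : C) :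
    projectiveDimension (F.obj X) ≤ projectiveDimension X :=
  -- The dimension is an infimum of bounds in `WithBot ℕ∞`, and every bound for `X` is one for
  -- `F.obj X`; the values `⊥` and `⊤` need no separate treatment.
  sInf_le_sInf fun _ hn i hi =>
    have := hn i hi
    adj.hasProjectiveDimensionLT_obj X i

/-- The right adjoint in an adjunction of exact functors does not raise injective dimensions. -/
lemma Adjunction.injectiveDimension_obj_le (adj : F ⊣ G) (Y : D) :
    injectiveDimension (G.obj Y) ≤ injectiveDimension Y :=
  sInf_le_sInf fun _ hn i hi =>
    have := hn i hi
    adj.hasInjectiveDimensionLT_obj Y i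

end CategoryTheory

end exactAdjunction

/-! ### Colinearity of the tensor-hom maps -/

namespace YDModule

variable {k : Type u} {H : Type v} [Field k] [CommRing H] [HopfAlgebra k H]
variable {M : Type w} [AddCommGroup M] [Module k M] [Module H M] [IsScalarTower k H M]
variable {N : Type w} [AddCommGroup N] [Module k N] [Module H N] [IsScalarTower k H N]
variable {P : Type w} [AddCommGroup P] [Module k P] [Module H P] [IsScalarTower k H P]

/-- A map `γ` with `γ(Δ(h)) = ε(h) 1` cancels the two coactions in `m₀ ⊗ m₁ ⊗ m₂`. -/
lemma lTensor_coact_coact [YDModule k H M] (γ : H ⊗[k] H →ₗ[k] H)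
    (hγ : ∀ h : H, γ (Coalgebra.comul (R := k) h) = algebraMap k H (Coalgebra.counit h)) (m : M) :
    γ.lTensor M (TensorProduct.assoc k M H H (coact.rTensor H (coact m))) = m ⊗ₜ[k] (1 : H) := by
  have hγ' : γ ∘ₗ Coalgebra.comul = Algebra.linearMap k H ∘ₗ Coalgebra.counit := LinearMap.ext hγ
  have h : ∀ t : M ⊗[k] k, (Algebra.linearMap k H).lTensor M t =
      TensorProduct.rid k M t ⊗ₜ[k] (1 : H) := by
    intro t
    induction t with
    | zero => simp
    | add x y hx hy => simp only [map_add, TensorProduct.add_tmul, hx, hy]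
    | tmul m c => simp [Algebra.algebraMap_eq_smul_one, TensorProduct.smul_tmul]
  -- Coassociativity turns the second coaction into `Δ`, on which `γ` is the counit followed by the
  -- unit of `H`; the counit axiom of the comodule then leaves `m ⊗ 1`.
  rw [coassoc, ← LinearMap.lTensor_comp_apply, hγ', LinearMap.lTensor_comp_apply, h, counit]

lemma rTensor_tensorMul (f : M →ₗ[H] P) (s : M ⊗[k] H) (t : N ⊗[k] H) :
    ((f.rTensor N).restrictScalars k).rTensor H (tensorMul k H M N s t) =
      tensorMul k H P N ((f.restrictScalars k).rTensor H s) t := by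
  induction s with
  | zero => simp
  | add x y hx hy => simp only [map_add, LinearMap.add_apply, hx, hy]
  | tmul m a =>
    induction t with
    | zero => simp
    | add x y hx hy => simp only [map_add, hx, hy]
    | tmul n b => simp

lemma tensorCoact_rTensor [YDModule k H M] [YDModule k H N] [YDModule k H P] (f : M →ₗ[H] P)
    (hf : ∀ m, coact (k := k) (H := H) (f m) = (f.restrictScalars k).rTensor H (coact m))
    (x : M ⊗[H] N) : tensorCoact k H P N (f.rTensor N x) =
      ((f.rTensor N).restrictScalars k).rTensor H (tensorCoact k H M N x) := by
  induction x with
  | zero => simp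
  | add x y hx hy => simp only [map_add, hx, hy]
  | tmul m n =>
    rw [LinearMap.rTensor_tmul, tensorCoact_tmul, tensorCoact_tmul, rTensor_tensorMul, hf]

lemma homMul_comp [YDModule k H N] [YDModule k H P] (f : M →ₗ[H] N) (g : N →ₗ[H] P)
    (hg : ∀ n, coact (k := k) (H := H) (g n) = (g.restrictScalars k).rTensor H (coact n))
    (t : M ⊗[k] H) :
    homMul (g ∘ₗ f) t = (g.restrictScalars k).rTensor H (homMul f t) := by
  induction t with
  | zero => simp
  | add x y hx hy => simp only [map_add, hx, hy]
  | tmul n a => rw [homMul_tmul, homMul_tmul, act_map, LinearMap.comp_apply, hg]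

/-- The coaction on `Hom` is characterized by its evaluations, and these separate the elements of
`Hom ⊗ H` (`homTensor_ext`). After evaluation, the claim is that `f(n)₀ ⊗ f(n)₁ S(a)` is compatible
with postcomposition by a colinear map, which is `homMul_comp`. -/
lemma homCoact_compRight [YDModule k H M] [YDModule k H N] [YDModule k H P] [Module.Finite H M]
    (g : N →ₗ[H] P)
    (hg : ∀ n, coact (k := k) (H := H) (g n) = (g.restrictScalars k).rTensor H (coact n))
    (f : M →ₗ[H] N) : homCoact k H M P (LinearMap.compRight H g f) =
      ((LinearMap.compRight H (M := M) g).restrictScalars k).rTensor H (homCoact k H M N f) := by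
  refine homTensor_ext _ _ fun m => ?_
  have h : (ev (M := M) (N := P) k m).rTensor H
      (((LinearMap.compRight H (M := M) g).restrictScalars k).rTensor H (homCoact k H M N f)) =
      (g.restrictScalars k).rTensor H ((ev k m).rTensor H (homCoact k H M N f)) := by
    rw [← LinearMap.rTensor_comp_apply, ← LinearMap.rTensor_comp_apply]
    rfl
  rw [h, homCoact_spec', homCoact_spec']
  exact homMul_comp f g hg _

/-- The map `m ↦ (n ↦ m ⊗ n)` is colinear. -/
lemma homCoact_mk [YDModule k H M] [YDModule k H N] [Module.Finite H N] (m : M) :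
    homCoact k H N (M ⊗[H] N) (TensorProduct.mk H M N m) =
      ((TensorProduct.mk H M N).restrictScalars k).rTensor H (coact m) := by
  refine homTensor_ext _ _ fun n => ?_
  -- Commutativity of `H` gives `n₁ m₁ S(a) = (n₁ S(a)) m₁`, so the antipode only meets the coaction
  -- of `n`. For `u = ρ(n)` the factor `n₀ ⊗ n₁ S(n₂)` collapses to `n ⊗ 1`.
  have h1 : ∀ u : N ⊗[k] H, homMul (TensorProduct.mk H M N m) u =
      tensorMul k H M N (coact m)
        ((LinearMap.mul' k H ∘ₗ (HopfAlgebra.antipode k).lTensor H).lTensor N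
          (TensorProduct.assoc k N H H (coact.rTensor H u))) := by
    intro u
    induction u with
    | zero => simp
    | add x y hx hy => simp only [map_add, hx, hy]
    | tmul n a =>
      rw [homMul_tmul, TensorProduct.mk_apply]
      refine (congrArg _ (tensorCoact_tmul m n)).trans ?_
      rw [← tensorMul_act_right, LinearMap.rTensor_tmul]
      congr 1
      induction coact (k := k) (H := H) n with
      | zero => simp
      | add x y hx hy => simp only [map_add, TensorProduct.add_tmul, hx, hy]
      | tmul n b => simp [mul_comm]
  have h2 : ∀ s : M ⊗[k] H, tensorMul k H M N s (n ⊗ₜ 1) =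
      (ev (M := N) (N := M ⊗[H] N) k n).rTensor H
        (((TensorProduct.mk H M N).restrictScalars k).rTensor H s) := by
    intro s
    induction s with
    | zero => simp
    | add x y hx hy => simp only [map_add, LinearMap.add_apply, hx, hy]
    | tmul m a => simp
  rw [homCoact_spec', h1, lTensor_coact_coact, h2]
  exact fun h => HopfAlgebra.mul_antipode_lTensor_comul_apply h

/-- Evaluation `f ⊗ n ↦ f n` is colinear. -/
lemma coact_lift_id [YDModule k H N] [YDModule k H P] [Module.Finite H N]
    (x : (N →ₗ[H] P) ⊗[H] N) :
    coact (k := k) (H := H) (TensorProduct.lift (LinearMap.id : (N →ₗ[H] P) →ₗ[H] _) x) =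
      ((TensorProduct.lift (LinearMap.id : (N →ₗ[H] P) →ₗ[H] _)).restrictScalars k).rTensor H
        (tensorCoact k H (N →ₗ[H] P) N x) := by
  induction x with
  | zero => simp
  | add x y hx hy => simp only [map_add, hx, hy]
  | tmul f n =>
    let E := (TensorProduct.lift (LinearMap.id : (N →ₗ[H] P) →ₗ[H] (N →ₗ[H] P))).restrictScalars k
    -- `Ψ(n ⊗ c)` is `f(n)₀ ⊗ c f(n)₁`. The right side of the goal becomes `f(n₀)₀ ⊗ f(n₀)₁ S(n₁) n₂
    -- = Ψ(n₀ ⊗ S(n₁) n₂)`, which collapses to `Ψ(n ⊗ 1) = ρ(f n)`.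
    let Ψ : N ⊗[k] H →ₗ[k] P ⊗[k] H := TensorProduct.lift (LinearMap.flip
      ((act k H P).toLinearMap ∘ₗ
        (Algebra.TensorProduct.includeRight : H →ₐ[k] H ⊗[k] H).toLinearMap) ∘ₗ
        coact ∘ₗ f.restrictScalars k)
    have hΨ : ∀ n c, Ψ (n ⊗ₜ c) = act k H P (1 ⊗ₜ c) (coact (f n)) := fun _ _ => rfl
    have h1 : ∀ (t : (N →ₗ[H] P) ⊗[k] H) (n : N) (a : H),
        E.rTensor H (tensorMul k H (N →ₗ[H] P) N t (n ⊗ₜ a)) =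
          act k H P (1 ⊗ₜ a) ((ev k n).rTensor H t) := by
      intro t n a
      induction t with
      | zero => simp
      | add x y hx hy => simp only [map_add, LinearMap.add_apply, hx, hy]
      | tmul f b => simp [E]
    have h2 : ∀ (a : H) (u : N ⊗[k] H), act k H P (1 ⊗ₜ a) (homMul f u) =
        Ψ ((LinearMap.mul' k H ∘ₗ (HopfAlgebra.antipode k).rTensor H).lTensor N
          (TensorProduct.assoc k N H H (u ⊗ₜ a))) := by
      intro a u
      induction u with
      | zero => simp
      | add x y hx hy => simp only [map_add, TensorProduct.add_tmul, hx, hy]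
      | tmul n b =>
        rw [homMul_tmul, ← act_mul_apply]
        simp [hΨ, mul_comm]
    have h3 : ∀ u : N ⊗[k] H,
        E.rTensor H (tensorMul k H (N →ₗ[H] P) N (homCoact k H N P f) u) =
        Ψ ((LinearMap.mul' k H ∘ₗ (HopfAlgebra.antipode k).rTensor H).lTensor N
          (TensorProduct.assoc k N H H (coact.rTensor H u))) := by
      intro u
      induction u with
      | zero => simp
      | add x y hx hy => simp only [map_add, hx, hy]
      | tmul n a => rw [h1, homCoact_spec', h2, LinearMap.rTensor_tmul]
    rw [tensorCoact_tmul]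
    refine Eq.trans ?_ (h3 (coact n)).symm
    rw [lTensor_coact_coact, hΨ, ← Algebra.TensorProduct.one_def, map_one]
    · rfl
    · exact fun h => HopfAlgebra.mul_antipode_rTensor_comul_apply h

end YDModule

/-! ### The adjunction on Yetter-Drinfeld modules and exactness of its two functors -/

namespace YetterDrinfeld
open YDModule Limits

variable {k : Type u} {H : Type v} [Field k] [CommRing H] [HopfAlgebra k H]

/-- The functor `- ⊗_H N`. -/
noncomputable def tensorFunctor (N : YetterDrinfeld.{w} k H) :
    YetterDrinfeld.{w} k H ⥤ YetterDrinfeld.{w} k H where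
  obj M := M.tensorObj N
  map {M M'} f := ofLin (M := M.tensorObj N) (N := M'.tensorObj N) ((lin f).rTensor N)
    (tensorCoact_rTensor (lin f) (lin_colinear f))
  map_id M := lin_injective (LinearMap.rTensor_id N M)
  map_comp f g := lin_injective (LinearMap.rTensor_comp N (lin g) (lin f))

instance (N : YetterDrinfeld.{w} k H) : N.tensorFunctor.Additive where
  map_add {_ _ f g} := lin_injective (LinearMap.rTensor_add N (lin f) (lin g))

variable (N : YetterDrinfeld.{w} k H) [Module.Finite H N]

/-- The functor `Hom_H(N, -)`. -/
noncomputable def homFunctor : YetterDrinfeld.{w} k H ⥤ YetterDrinfeld.{w} k H where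
  obj P := N.homObj P
  map {P P'} g := ofLin (M := N.homObj P) (N := N.homObj P') (LinearMap.compRight H (lin g))
    (homCoact_compRight (lin g) (lin_colinear g))
  map_id _ := lin_injective rfl
  map_comp _ _ := lin_injective rfl

instance : N.homFunctor.Additive where
  map_add := lin_injective (LinearMap.ext fun _ => LinearMap.ext fun _ => rfl)

/-- The map `m ↦ (n ↦ m ⊗ n)` from `M` to `Hom_H(N, M ⊗_H N)`. -/
noncomputable def tensorHomUnit (M : YetterDrinfeld.{w} k H) : M ⟶ N.homObj (M.tensorObj N) :=
  ofLin (M := M) (N := N.homObj (M.tensorObj N)) (TensorProduct.mk H M N) homCoact_mk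

/-- The evaluation map from `Hom_H(N, P) ⊗_H N` to `P`. -/
noncomputable def tensorHomCounit (P : YetterDrinfeld.{w} k H) :
    (N.homObj P).tensorObj N ⟶ P :=
  ofLin (M := (N.homObj P).tensorObj N) (N := P)
    (TensorProduct.lift (LinearMap.id : (N →ₗ[H] P) →ₗ[H] (N →ₗ[H] P))) coact_lift_id

/-- The adjunction between `- ⊗_H N` and `Hom_H(N, -)`. -/
noncomputable def tensorHomAdjunction : N.tensorFunctor ⊣ N.homFunctor where
  -- Morphisms are determined by their underlying `H`-linear maps, and there this is the ordinary
  -- tensor-hom adjunction: naturality and the triangle identities hold by definition on elements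
  -- and pure tensors.
  unit :=
    { app := N.tensorHomUnit
      naturality := fun _ _ _ =>
        lin_injective (LinearMap.ext fun _ => LinearMap.ext fun _ => rfl) }
  counit :=
    { app := N.tensorHomCounit
      naturality := fun _ _ _ => lin_injective (TensorProduct.ext' fun _ _ => rfl) }
  left_triangle_components _ := lin_injective (TensorProduct.ext' fun _ _ => rfl)
  right_triangle_components _ :=
    lin_injective (LinearMap.ext fun _ => LinearMap.ext fun _ => rfl)

instance : PreservesFiniteColimits N.tensorFunctor :=
  have := N.tensorHomAdjunction.leftAdjoint_preservesColimits
  inferInstance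

instance : PreservesFiniteLimits N.homFunctor :=
  have := N.tensorHomAdjunction.rightAdjoint_preservesLimits
  inferInstance

variable [Module.Projective H N]

/-- Right exactness already preserves exactness in the middle. What remains is that monomorphisms
are preserved; these are the injective maps, and a projective `N` is flat over `H`. -/
instance : PreservesFiniteLimits N.tensorFunctor :=
  (Functor.preservesFiniteLimits_iff_forall_exact_map_and_mono _).2 fun S hS =>
    ⟨((Functor.preservesFiniteColimits_iff_forall_exact_map_and_epi _).1 inferInstance S hS).1,
      have := hS.mono_f
      mono_of_injective (N.tensorFunctor.map S.f)
        (Module.Flat.rTensor_preserves_injective_linearMap (lin S.f) (injective_of_mono S.f))⟩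

/-- Left exactness leaves only the preservation of epimorphisms. Since surjective morphisms are
epimorphisms, it is enough to lift `f : N → S.X₃` through `S.g` as an `H`-linear map; the lift need
not be colinear, so projectivity of `N` over `H` suffices. -/
instance : PreservesFiniteColimits N.homFunctor :=
  (Functor.preservesFiniteColimits_iff_forall_exact_map_and_epi _).2 fun S hS =>
    ⟨((Functor.preservesFiniteLimits_iff_forall_exact_map_and_mono _).1 inferInstance S hS).1,
      have := hS.epi_g
      epi_of_surjective (N.homFunctor.map S.g) fun f =>
        Module.projective_lifting_property (lin S.g) f (surjective_of_epi S.g)⟩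

end YetterDrinfeld

theorem corollary2p3 {k : Type u} {H : Type v} [Field k] [CommRing H] [HopfAlgebra k H]
    (M N P : YetterDrinfeld.{w} k H) [Module.Finite H N] [Module.Projective H N] :
    projectiveDimension (M.tensorObj N) ≤ projectiveDimension M ∧
      injectiveDimension (N.homObj P) ≤ injectiveDimension P := by
  exact ⟨N.tensorHomAdjunction.projectiveDimension_obj_le M,
    N.tensorHomAdjunction.injectiveDimension_obj_le P⟩
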